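/- Let $F$ be a number field, $\bar F$ an algebraic closure of $F$, $\Gamma=\mathrm{Gal}(\bar F/F)$, and let $V$ be the set of all places of $F$. For every $v\in V$ fix a place $\dot v$ of $\bar F$ above $v$, with decomposition group $\Gamma_{\dot v}\subset\Gamma$, and let $\dot V=\{\dot v\mid v\in V\}$; assume that $\bigcup_{v\in V}\Gamma_{\dot v}$ is dense in $\Gamma$. For a finite Galois extension $E/F$ inside $\bar F$ and a set $S\subset V$ write $\Gamma_{E/F}=\mathrm{Gal}(E/F)$, let $S_E$ be the set of places of $E$ above $S$, and let $\dot S_E=\{\dot v|_E\mid v\in S\}\subset S_E$. Define two $\Gamma_{E/F}$-modules. $M^{\mathrm{iso}}_{E,S}=\mathbb Z[S_E]_0$ is the group of finitely supported functions $f:S_E\to\mathbb Z$ with $\sum_w f(w)=0$. $M^{\mathrm{mid}}_{E,\dot S_E}$ is the group of finitely supported functions $f:\Gamma_{E/F}\times S_E\to\frac1{[E:F]}\mathbb Z$ such that $\sum_w f(\sigma,w)=0$ for all $\sigma$, $\sum_\sigma f(\sigma,w)\in\mathbb Z$ for all $w$, and $f(\sigma,w)=0$ unless $\sigma^{-1}w\in\dot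 S_E$. The group $\Gamma_{E/F}$ acts by $(\tau f)(w)=f(\tau^{-1}w)$ and $(\tau f)(\sigma,w)=f(\tau^{-1}\sigma,\tau^{-1}w)$. The map $c^{\mathrm{iso}}:M^{\mathrm{mid}}_{E,\dot S_E}\to M^{\mathrm{iso}}_{E,S}$, $c^{\mathrm{iso}}(f)(w)=\sum_\sigma f(\sigma,w)$, is equivariant. For $E\subset K$ and $S\subset S'$ there are equivariant inflation maps $M^{\mathrm{iso}}_{E,S}\to M^{\mathrm{iso}}_{K,S'}$ and $M^{\mathrm{mid}}_{E,\dot S_E}\to M^{\mathrm{mid}}_{K,\dot S'_K}$, with which $c^{\mathrm{iso}}$ is compatible: for a place $u$ of $K$ above the place $w$ of $E$, the first sends $f$ to $u\mapsto[K_u:E_w]f(w)$, and the second sends $f$ to the function with value $f(\sigma|_E,w)$ at $(\sigma,u)$ if $\sigma^{-1}u\in\dot S_K$, and value $0$ otherwise (functions being extended by $0$ to all places). Let $\mathbb T^{\mathrm{iso}}_{E,S}$ and $\mathbb T^{\mathrm{mid}}_{E,\dot S_E}$ be the $F$-tori with these character modules, for $S$ finite, and let $\mathbb T^{\mathrm{iso}}=\varprojlim_{(E,S)}\mathbb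 T^{\mathrm{iso}}_{E,S}$ and $\mathbb T^{\mathrm{mid}}_{\dot V}=\varprojlim_{(E,S)}\mathbb T^{\mathrm{mid}}_{E,\dot S_E}$ be the resulting pro-tori, over all finite Galois $E/F$ in $\bar F$ and all finite $S\subset V$, with transition maps dual to inflation. Let $c_{\mathrm{iso}}:\mathbb T^{\mathrm{iso}}\to\mathbb T^{\mathrm{mid}}_{\dot V}$ be the homomorphism dual to the maps $c^{\mathrm{iso}}$. Then $c_{\mathrm{iso}}$ splits: there is a homomorphism $s:\mathbb T^{\mathrm{mid}}_{\dot V}\to\mathbb T^{\mathrm{iso}}$ over $F$ with $s\circ c_{\mathrm{iso}}=\mathrm{id}$. More precisely, for every increasing sequence $E_0\subset E_1\subset\cdots$ of finite Galois extensions of $F$ with $\bigcup_i E_i=\bar F$, there are $\Gamma_{E_i/F}$-equivariant homomorphisms $s_i:M^{\mathrm{iso}}_{E_i,V}\to M^{\mathrm{mid}}_{E_i,\dot V_{E_i}}$ with $c^{\mathrm{iso}}\circ s_i=\mathrm{id}$ that are compatible with the inflation maps from $E_i$ to $E_{i+1}$, and a homomorphism $s:\mathbb T^{\mathrm{mid}}_{\dot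 V}\to\mathbb T^{\mathrm{iso}}$ over $F$ with $s\circ c_{\mathrm{iso}}=\mathrm{id}$ such that pulling back characters along $s$ is given by the $s_i$. -/

import Mathlib

open scoped TensorProduct Topology

universe u

namespace GaloisGerbe

/-! ### Places of a field -/

/-- A place of a field `L`: an equivalence class of nontrivial real-valued absolute values. -/
def Place (L : Type*) [Field L] : Type _ :=
  Quotient (Setoid.comap
    (Subtype.val : {v : AbsoluteValue L ℝ // v.IsNontrivial} → AbsoluteValue L ℝ) inferInstance)

/-- The place defined by a nontrivial absolute value. -/
def Place.mk {L : Type*} [Field L] (v : AbsoluteValue L ℝ) (hv : v.IsNontrivial) : Place L :=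
  Quotient.mk _ ⟨v, hv⟩

/-- An absolute value representing the place `w`. -/
noncomputable def Place.rep {L : Type*} [Field L] (w : Place L) : AbsoluteValue L ℝ :=
  (Quotient.out w).1

theorem Place.rep_isNontrivial {L : Type*} [Field L] (w : Place L) : w.rep.IsNontrivial :=
  (Quotient.out w).2

theorem Place.mk_rep {L : Type*} [Field L] (w : Place L) :
    Place.mk w.rep w.rep_isNontrivial = w := Quotient.out_eq w

theorem Place.mk_eq_mk {L : Type*} [Field L] {v v' : AbsoluteValue L ℝ} {hv : v.IsNontrivial}
    {hv' : v'.IsNontrivial} : Place.mk v hv = Place.mk v' hv' ↔ v.IsEquiv v' := by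
  constructor
  · intro h
    exact Quotient.exact h
  · intro h
    exact Quotient.sound h

/-- The pull-back of an absolute value along an embedding of fields. -/
def absComap {K L : Type*} [Field K] [Field L] (φ : K →+* L) (v : AbsoluteValue L ℝ) :
    AbsoluteValue K ℝ := v.comp φ.injective

@[simp] theorem absComap_apply {K L : Type*} [Field K] [Field L] (φ : K →+* L)
    (v : AbsoluteValue L ℝ) (x : K) : absComap φ v x = v (φ x) := rfl

/-- A nontrivial absolute value stays nontrivial on a subfield over which the field is
algebraic. -/
theorem absComap_isNontrivial {K L : Type*} [Field K] [Field L] (φ : K →+* L)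
    (hφ : φ.IsIntegral) {v : AbsoluteValue L ℝ} (hv : v.IsNontrivial) :
    (absComap φ v).IsNontrivial := by
  by_contra hn
  have htriv : ∀ a : K, v (φ a) ≤ 1 := by
    intro a
    by_cases ha : a = 0
    · simp [ha]
    · by_contra hlt
      exact hn ⟨a, ha, by simpa using fun h => hlt (le_of_eq h)⟩
  obtain ⟨x, hx⟩ := hv.exists_abv_gt_one
  obtain ⟨p, hp, hpx⟩ := hφ x
  have hbound : ∀ m : ℕ, v x ^ m ≤ ∑ i ∈ Finset.range (p.natDegree + 1), v x ^ i := by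
    intro m
    have h1 : x ^ m = (((Polynomial.X : Polynomial K) ^ m) %ₘ p).eval₂ φ x := by
      have h2 := Polynomial.modByMonic_add_div ((Polynomial.X : Polynomial K) ^ m) p
      have h3 := congrArg (Polynomial.eval₂ φ x) h2
      rw [Polynomial.eval₂_add, Polynomial.eval₂_mul, hpx, zero_mul, add_zero] at h3
      rw [h3]; simp
    rw [← map_pow, h1, Polynomial.eval₂_eq_sum_range' φ
      (n := p.natDegree + 1) (Nat.lt_succ_of_le (Polynomial.natDegree_modByMonic_le _ hp))]
    refine (v.sum_le _ _).trans (Finset.sum_le_sum fun i _ => ?_)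
    rw [map_mul, map_pow]
    exact mul_le_of_le_one_left (pow_nonneg (v.nonneg _) _) (htriv _)
  obtain ⟨n, hn'⟩ := pow_unbounded_of_one_lt
    (∑ i ∈ Finset.range (p.natDegree + 1), v x ^ i) hx
  exact absurd (hbound n) (not_le.mpr hn')

/-- The restriction of a place along an algebraic embedding of fields. -/
def Place.comap {K L : Type*} [Field K] [Field L] (φ : K →+* L) (hφ : φ.IsIntegral) :
    Place L → Place K :=
  Quotient.map (fun v => ⟨absComap φ v.1, absComap_isNontrivial φ hφ v.2⟩)
    (fun _ _ h x y => h (φ x) (φ y))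

theorem Place.comap_mk {K L : Type*} [Field K] [Field L] (φ : K →+* L) (hφ : φ.IsIntegral)
    (v : AbsoluteValue L ℝ) (hv : v.IsNontrivial) :
    Place.comap φ hφ (Place.mk v hv) =
      Place.mk (absComap φ v) (absComap_isNontrivial φ hφ hv) := rfl

theorem Place.ind {L : Type*} [Field L] {P : Place L → Prop}
    (h : ∀ v hv, P (Place.mk v hv)) (w : Place L) : P w :=
  Quotient.ind (fun v => h v.1 v.2) w

/-- The place of `E` lying under the place `w` of an algebraic extension `K` of `E`. -/
def Place.under (E : Type*) {K : Type*} [Field E] [Field K] [Algebra E K]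
    [Algebra.IsAlgebraic E K] (w : Place K) : Place E :=
  Place.comap (algebraMap E K) (algebraMap_isIntegral_iff.mpr inferInstance) w

theorem Place.under_under (F E : Type*) {K : Type*} [Field F] [Field E] [Field K] [Algebra F E]
    [Algebra E K] [Algebra F K] [IsScalarTower F E K] [Algebra.IsAlgebraic F E]
    [Algebra.IsAlgebraic E K] [Algebra.IsAlgebraic F K] (w : Place K) :
    Place.under F (Place.under E w) = Place.under F w := by
  induction w using Place.ind with
  | h v hv =>
    refine Place.mk_eq_mk.mpr (fun x y => ?_)
    simp [IsScalarTower.algebraMap_apply F E K]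

theorem isIntegral_of_algEquiv {E K : Type*} [Field E] [Field K] [Algebra E K] (σ : Gal(K/E)) :
    (σ.toRingEquiv.toRingHom : K →+* K).IsIntegral := fun x =>
  ⟨Polynomial.X - Polynomial.C (σ.symm x), Polynomial.monic_X_sub_C _, by simp⟩

/-- The Galois action on places: `|x|_{σ w} = |σ⁻¹ x|_w`. -/
noncomputable instance Place.mulAction {E K : Type*} [Field E] [Field K] [Algebra E K] :
    MulAction Gal(K/E) (Place K) where
  smul σ w := Place.comap (σ⁻¹).toRingEquiv.toRingHom (isIntegral_of_algEquiv σ⁻¹) w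
  one_smul w := by
    induction w using Place.ind with
    | h v hv => exact Place.mk_eq_mk.mpr (fun x y => Iff.rfl)
  mul_smul σ τ w := by
    induction w using Place.ind with
    | h v hv =>
      refine Place.mk_eq_mk.mpr (fun x y => ?_)
      simp [mul_inv_rev]

theorem Place.smul_mk {E K : Type*} [Field E] [Field K] [Algebra E K] (σ : Gal(K/E))
    (v : AbsoluteValue K ℝ) (hv : v.IsNontrivial) :
    σ • Place.mk v hv = Place.mk (absComap (σ⁻¹).toRingEquiv.toRingHom v)
      (absComap_isNontrivial _ (isIntegral_of_algEquiv σ⁻¹) hv) := rfl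

/-- Compatibility of restriction of places with restriction of automorphisms. -/
theorem Place.under_smul {F E K : Type*} [Field F] [Field E] [Field K] [Algebra F E]
    [Algebra E K] [Algebra F K] [IsScalarTower F E K] [Normal F E] [Algebra.IsAlgebraic E K]
    (σ : Gal(K/F)) (w : Place K) :
    Place.under E (σ • w) = AlgEquiv.restrictNormalHom E σ • Place.under E w := by
  induction w using Place.ind with
  | h v hv =>
    refine Place.mk_eq_mk.mpr (fun x y => ?_)
    have h : ∀ z : E, (σ⁻¹) (algebraMap E K z) =
        algebraMap E K ((AlgEquiv.restrictNormalHom E σ)⁻¹ z) := by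
      intro z
      rw [← map_inv]
      exact (AlgEquiv.restrictNormal_commutes σ⁻¹ E z).symm
    change v ((σ⁻¹) _) ≤ v ((σ⁻¹) _) ↔ v (algebraMap E K _) ≤ v (algebraMap E K _)
    exact iff_of_eq (congrArg₂ (fun a b => v a ≤ v b) (h x) (h y))

theorem Place.under_smul_self {E K : Type*} [Field E] [Field K] [Algebra E K]
    [Algebra.IsAlgebraic E K] (σ : Gal(K/E)) (w : Place K) :
    Place.under E (σ • w) = Place.under E w := by
  induction w using Place.ind with
  | h v hv =>
    refine Place.mk_eq_mk.mpr (fun x y => ?_)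
    change v ((σ⁻¹) (algebraMap E K _)) ≤ v ((σ⁻¹) (algebraMap E K _)) ↔ _
    exact iff_of_eq (congrArg₂ (fun a b => v a ≤ v b) (σ⁻¹.commutes x) (σ⁻¹.commutes y))

theorem Place.restrictScalars_smul (F : Type*) {E K : Type*} [Field F] [Field E] [Field K]
    [Algebra F E] [Algebra E K] [Algebra F K] [IsScalarTower F E K]
    (σ : Gal(K/E)) (w : Place K) : (AlgEquiv.restrictScalars F σ : Gal(K/F)) • w = σ • w := by
  induction w using Place.ind with
  | h v hv => exact Place.mk_eq_mk.mpr (fun x y => Iff.rfl)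

/-- The Galois group permutes transitively the places above a given place. -/
theorem Place.exists_smul_eq {E K : Type*} [Field E] [Field K] [Algebra E K]
    [FiniteDimensional E K] [IsGalois E K] {u u' : Place K}
    (h : Place.under E u = Place.under E u') : ∃ τ : Gal(K/E), τ • u = u' := by
  classical
  by_contra hne
  push Not at hne
  -- the finitely many conjugates of `u` and of `u'`
  let S : Finset (Place K) := Finset.univ.image (fun τ : Gal(K/E) => τ • u)
  let S' : Finset (Place K) := Finset.univ.image (fun τ : Gal(K/E) => τ • u')
  have hdisj : ∀ x ∈ S, x ∉ S' := by
    intro x hx hx'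
    obtain ⟨τ, -, rfl⟩ := Finset.mem_image.mp hx
    obtain ⟨τ', -, h'⟩ := Finset.mem_image.mp hx'
    refine hne (τ'⁻¹ * τ) ?_
    rw [mul_smul, ← h', inv_smul_smul]
  let ι := {x : Place K // x ∈ S ∪ S'}
  have hdense := AbsoluteValue.denseRange_algebraMap_pi (F := K) (ι := ι)
    (v := fun i => i.1.rep) (fun i => i.1.rep_isNontrivial) (by
      intro i j hij he
      apply hij
      apply Subtype.ext
      rw [← Place.mk_rep i.1, ← Place.mk_rep j.1, Place.mk_eq_mk]
      exact he)
  let z : (i : ι) → WithAbs (i.1.rep) := fun i =>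
    if i.1 ∈ S then 0 else WithAbs.toAbs _ (Classical.choose i.1.rep_isNontrivial.exists_abv_gt_one)
  have hopen : IsOpen {y : (i : ι) → WithAbs (i.1.rep) |
      ∀ i, if i.1 ∈ S then ‖y i‖ < 1 else 1 < ‖y i‖} := by
    rw [Set.ofPred_forall]
    refine isOpen_iInter_of_finite fun i => ?_
    by_cases hi : i.1 ∈ S
    · simp only [hi, if_true]
      exact isOpen_lt (continuous_apply i).norm continuous_const
    · simp only [hi, if_false]
      exact isOpen_lt continuous_const (continuous_apply i).norm
  obtain ⟨a, ha⟩ := hdense.exists_mem_open hopen ⟨z, by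
    intro i
    by_cases hi : i.1 ∈ S
    · simp [hi, z]
    · simp only [hi, if_false, z]
      rw [WithAbs.norm_eq_apply_ofAbs]
      exact Classical.choose_spec i.1.rep_isNontrivial.exists_abv_gt_one⟩
  -- a representative-independent form
  have key : ∀ (w : Place K) (τ : Gal(K/E)), (τ • w).rep a < 1 ↔ w.rep (τ⁻¹ a) < 1 := by
    intro w τ
    have h1 : Place.mk (τ • w).rep (τ • w).rep_isNontrivial = τ • Place.mk w.rep w.rep_isNontrivial := by
      rw [Place.mk_rep, Place.mk_rep]
    rw [Place.smul_mk, Place.mk_eq_mk] at h1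
    exact h1.lt_one_iff
  have key' : ∀ (w : Place K) (τ : Gal(K/E)), 1 < (τ • w).rep a ↔ 1 < w.rep (τ⁻¹ a) := by
    intro w τ
    have h1 : Place.mk (τ • w).rep (τ • w).rep_isNontrivial = τ • Place.mk w.rep w.rep_isNontrivial := by
      rw [Place.mk_rep, Place.mk_rep]
    rw [Place.smul_mk, Place.mk_eq_mk] at h1
    exact h1.one_lt_iff
  have hu : ∀ τ : Gal(K/E), u.rep (τ a) < 1 := by
    intro τ
    have hm : τ⁻¹ • u ∈ S := Finset.mem_image_of_mem _ (Finset.mem_univ _)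
    have h2 := ha ⟨τ⁻¹ • u, Finset.mem_union_left _ hm⟩
    simp only [hm, if_true] at h2
    have h3 := (key u τ⁻¹).mp h2
    simpa using h3
  have hu' : ∀ τ : Gal(K/E), 1 < u'.rep (τ a) := by
    intro τ
    have hm : τ⁻¹ • u' ∈ S' := Finset.mem_image_of_mem _ (Finset.mem_univ _)
    have hm' : τ⁻¹ • u' ∉ S := fun hc => hdisj _ hc hm
    have h2 := ha ⟨τ⁻¹ • u', Finset.mem_union_right _ hm⟩
    simp only [hm', if_false] at h2
    have h3 := (key' u' τ⁻¹).mp h2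
    simpa using h3
  have hn := Algebra.norm_eq_prod_automorphisms E a
  have hτ0 : ∀ τ : Gal(K/E), τ a ≠ 0 := by
    intro τ h0
    have h1 := hu' τ
    rw [h0, map_zero] at h1
    linarith
  have e1 : u.rep (algebraMap E K (Algebra.norm E a)) < 1 := by
    rw [hn, map_prod]
    refine (Finset.prod_lt_prod_of_nonempty (f := fun τ : Gal(K/E) => u.rep (τ a))
      (g := fun _ => (1 : ℝ)) (fun τ _ => u.rep.pos (hτ0 τ)) (fun τ _ => hu τ)
      Finset.univ_nonempty).trans_eq ?_
    simp
  have e2 : 1 < u'.rep (algebraMap E K (Algebra.norm E a)) := by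
    rw [hn, map_prod]
    refine lt_of_eq_of_lt ?_ (Finset.prod_lt_prod_of_nonempty (f := fun _ => (1 : ℝ))
      (g := fun τ : Gal(K/E) => u'.rep (τ a)) (fun τ _ => one_pos) (fun τ _ => hu' τ)
      Finset.univ_nonempty)
    simp
  have h5 : Place.under E (Place.mk u.rep u.rep_isNontrivial) =
      Place.under E (Place.mk u'.rep u'.rep_isNontrivial) := by
    rw [Place.mk_rep, Place.mk_rep, h]
  have h6 : (absComap (algebraMap E K) u.rep).IsEquiv (absComap (algebraMap E K) u'.rep) :=
    Place.mk_eq_mk.mp h5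
  have h7 := h6.lt_one_iff.mp e1
  exact absurd e2 (not_lt.mpr (le_of_lt h7))

/-! ### Local degrees -/

/-- The completion `K_u` of `K` at the place `u`. -/
abbrev Place.Completion {K : Type*} [Field K] (u : Place K) : Type _ := u.rep.Completion

/-- The image of `E` in the completion `K_u`. -/
noncomputable def Place.baseSubfield (E : Type*) {K : Type*} [Field E] [Field K] [Algebra E K]
    (u : Place K) : Subfield u.Completion :=
  RingHom.fieldRange ((UniformSpace.Completion.coeRingHom : WithAbs u.rep →+* u.Completion).comp
    ((WithAbs.equiv u.rep).symm.toRingHom.comp (algebraMap E K)))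

/-- The local degree `[K_u : E_w]`, where `w` is the place of `E` under `u`; the completion `E_w`
is the closure of `E` in `K_u`. -/
noncomputable def Place.localDegree (E : Type*) {K : Type*} [Field E] [Field K] [Algebra E K]
    (u : Place K) : ℕ :=
  Module.finrank (Place.baseSubfield E u).topologicalClosure u.Completion

theorem continuous_withAbs_map {K : Type*} [Field K] {v w : AbsoluteValue K ℝ} (σ : K →+* K)
    (h : w.IsEquiv (absComap σ v)) : Continuous (WithAbs.map w v σ) := by
  have h1 : Continuous (WithAbs.congr w (absComap σ v) (.refl K)) :=
    h.isEmbedding_equivWithAbs.continuous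
  have h2 : Continuous (WithAbs.map (absComap σ v) v σ) := by
    refine (AddMonoidHomClass.isometry_of_norm _ (fun x => ?_)).continuous
    simp [WithAbs.norm_eq_apply_ofAbs]
  exact h2.comp h1

theorem Place.rep_isEquiv_of_smul_eq {E K : Type*} [Field E] [Field K] [Algebra E K]
    {σ : Gal(K/E)} {w u : Place K} (h : σ • w = u) :
    w.rep.IsEquiv (absComap σ.toRingEquiv.toRingHom u.rep) := by
  have h2 : w = σ⁻¹ • u := by rw [← h, inv_smul_smul]
  have h1 : Place.mk w.rep w.rep_isNontrivial = σ⁻¹ • Place.mk u.rep u.rep_isNontrivial := by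
    rw [Place.mk_rep, Place.mk_rep, h2]
  rw [Place.smul_mk, Place.mk_eq_mk] at h1
  simpa using h1

/-- The automorphism of the completion defined by an element of the decomposition group. -/
noncomputable def decompHom {E K : Type*} [Field E] [Field K] [Algebra E K]
    (u : Place K) (σ : MulAction.stabilizer Gal(K/E) u) : u.Completion →+* u.Completion :=
  UniformSpace.Completion.mapRingHom
    (WithAbs.map u.rep u.rep σ.1.toRingEquiv.toRingHom)
    (continuous_withAbs_map _ (Place.rep_isEquiv_of_smul_eq σ.2))

theorem decompHom_coe {E K : Type*} [Field E] [Field K] [Algebra E K]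
    (u : Place K) (σ : MulAction.stabilizer Gal(K/E) u) (x : K) :
    decompHom u σ (WithAbs.toAbs u.rep x : u.Completion) =
      (WithAbs.toAbs u.rep (σ.1 x) : u.Completion) := by
  unfold decompHom
  rw [UniformSpace.Completion.mapRingHom_coe]
  rfl

theorem decompHom_continuous {E K : Type*} [Field E] [Field K] [Algebra E K]
    (u : Place K) (σ : MulAction.stabilizer Gal(K/E) u) : Continuous (decompHom u σ) := by
  unfold decompHom
  rw [UniformSpace.Completion.coe_mapRingHom]
  exact UniformSpace.Completion.continuous_map

theorem decompHom_ext {K : Type*} [Field K] {u : Place K} {f g : u.Completion →+* u.Completion}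
    (hf : Continuous f) (hg : Continuous g)
    (h : ∀ x : K, f (WithAbs.toAbs u.rep x : u.Completion) =
      g (WithAbs.toAbs u.rep x : u.Completion)) : f = g := by
  ext x
  induction x using UniformSpace.Completion.induction_on with
  | hp => exact isClosed_eq hf hg
  | ih a => exact h a.ofAbs

/-- The action of the decomposition group on the completion. -/
noncomputable def decompAction {E K : Type*} [Field E] [Field K] [Algebra E K]
    (u : Place K) : MulAction.stabilizer Gal(K/E) u →* (u.Completion →+* u.Completion) where
  toFun := decompHom u
  map_one' := decompHom_ext (decompHom_continuous u 1) continuous_id (fun x => by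
    rw [decompHom_coe]; rfl)
  map_mul' σ τ := decompHom_ext (decompHom_continuous u _)
    ((decompHom_continuous u σ).comp (decompHom_continuous u τ)) (fun x => by
      rw [decompHom_coe, RingHom.mul_def, RingHom.comp_apply, decompHom_coe, decompHom_coe]; rfl)

theorem decompAction_coe {E K : Type*} [Field E] [Field K] [Algebra E K]
    (u : Place K) (σ : MulAction.stabilizer Gal(K/E) u) (x : K) :
    decompAction u σ (WithAbs.toAbs u.rep x : u.Completion) =
      (WithAbs.toAbs u.rep (σ.1 x) : u.Completion) := decompHom_coe u σ x

theorem decompAction_continuous {E K : Type*} [Field E] [Field K] [Algebra E K]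
    (u : Place K) (σ : MulAction.stabilizer Gal(K/E) u) : Continuous (decompAction u σ) :=
  decompHom_continuous u σ

theorem sum_decomp_mem {E K : Type*} [Field E] [Field K] [Algebra E K]
    [FiniteDimensional E K] [IsGalois E K] (u : Place K)
    [Fintype (MulAction.stabilizer Gal(K/E) u)] (a : K) :
    ∑ σ : MulAction.stabilizer Gal(K/E) u, (WithAbs.toAbs u.rep (σ.1 a) : u.Completion) ∈
      (Place.baseSubfield E u).topologicalClosure := by
  classical
  let S : Finset (Place K) := Finset.univ.image (fun τ : Gal(K/E) => τ • u)
  have hS : ∀ τ : Gal(K/E), τ • u ∈ S := fun τ => Finset.mem_image_of_mem _ (Finset.mem_univ _)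
  let ι := {x : Place K // x ∈ S}
  have hdense := AbsoluteValue.denseRange_algebraMap_pi (F := K) (ι := ι)
    (v := fun i => i.1.rep) (fun i => i.1.rep_isNontrivial) (by
      intro i j hij he
      apply hij
      apply Subtype.ext
      rw [← Place.mk_rep i.1, ← Place.mk_rep j.1, Place.mk_eq_mk]
      exact he)
  let z : (i : ι) → WithAbs (i.1.rep) := fun i => if i.1 = u then WithAbs.toAbs _ a else 0
  let l : Filter K := Filter.comap (algebraMap K ((i : ι) → WithAbs (i.1.rep))) (𝓝 z)
  have : l.NeBot := by
    rw [Filter.comap_neBot_iff_frequently, ← mem_closure_iff_frequently]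
    exact hdense z
  have hl : ∀ i : ι, Filter.Tendsto (fun y : K => WithAbs.toAbs i.1.rep y) l (𝓝 (z i)) :=
    fun i => by
      have h0 : Filter.Tendsto (algebraMap K ((i : ι) → WithAbs (i.1.rep))) l (𝓝 z) :=
        Filter.tendsto_comap
      exact (tendsto_pi_nhds.mp h0) i
  -- the limit of every conjugate
  have hlim : ∀ σ : Gal(K/E), Filter.Tendsto
      (fun y : K => (WithAbs.toAbs u.rep (σ y) : u.Completion)) l
      (𝓝 (if σ ∈ MulAction.stabilizer Gal(K/E) u then
        (WithAbs.toAbs u.rep (σ a) : u.Completion) else 0)) := by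
    intro σ
    have hc := continuous_withAbs_map _
      (Place.rep_isEquiv_of_smul_eq (σ := σ) (w := σ⁻¹ • u) (u := u) (smul_inv_smul _ _))
    have h1 := (hc.tendsto _).comp (hl ⟨σ⁻¹ • u, hS _⟩)
    have h2 := ((UniformSpace.Completion.continuous_coe (WithAbs u.rep)).tendsto _).comp h1
    have e : (if σ ∈ MulAction.stabilizer Gal(K/E) u then
        (WithAbs.toAbs u.rep (σ a) : u.Completion) else 0) =
        ((WithAbs.map (σ⁻¹ • u).rep u.rep σ.toRingEquiv.toRingHom) (z ⟨σ⁻¹ • u, hS _⟩) :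
          u.Completion) := by
      by_cases hσ : σ ∈ MulAction.stabilizer Gal(K/E) u
      · have h3 : σ⁻¹ • u = u := by
          rw [inv_smul_eq_iff]; exact hσ.symm
        simp only [hσ, if_true, z, h3]
        rfl
      · have h3 : σ⁻¹ • u ≠ u := by
          intro h4
          rw [inv_smul_eq_iff] at h4
          exact hσ h4.symm
        simp only [hσ, if_false, z, h3, map_zero]
        exact UniformSpace.Completion.coe_zero.symm
    rw [e]
    exact h2
  have hsum := tendsto_finsetSum Finset.univ (fun σ _ => hlim σ)
  rw [← Finset.sum_filter] at hsum
  have hs : ∑ σ : MulAction.stabilizer Gal(K/E) u,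
      (WithAbs.toAbs u.rep (σ.1 a) : u.Completion) =
      ∑ σ ∈ Finset.univ.filter (fun σ : Gal(K/E) => σ ∈ MulAction.stabilizer Gal(K/E) u),
        (WithAbs.toAbs u.rep (σ a) : u.Completion) :=
    (Finset.sum_subtype (p := fun σ => σ ∈ MulAction.stabilizer Gal(K/E) u) _ (by simp)
      (fun σ : Gal(K/E) => (WithAbs.toAbs u.rep (σ a) : u.Completion))).symm
  rw [hs]
  refine (Subfield.isClosed_topologicalClosure _).mem_of_tendsto hsum
    (Filter.Eventually.of_forall fun y => ?_)
  refine Subfield.le_topologicalClosure _ ⟨Algebra.trace E K y, ?_⟩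
  change ((WithAbs.toAbs u.rep (algebraMap E K (Algebra.trace E K y)) : WithAbs u.rep) :
    u.Completion) = _
  rw [trace_eq_sum_automorphisms]
  have : WithAbs.toAbs u.rep (∑ σ : Gal(K/E), σ y) = ∑ σ : Gal(K/E), WithAbs.toAbs u.rep (σ y) :=
    map_sum (WithAbs.equiv u.rep).symm _ _
  rw [this]
  exact map_sum (UniformSpace.Completion.coeRingHom : WithAbs u.rep →+* u.Completion) _ _

/-- Artin's theorem for a finite group of field automorphisms. -/
theorem finrank_eq_natCard_of_fixed {G C : Type*} [Group G] [Finite G] [Field C]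
    (ρ : G →* (C →+* C)) (hρ : Function.Injective ρ) (S : Subfield C)
    (hS : ∀ x, x ∈ S ↔ ∀ g, ρ g x = x) : Module.finrank S C = Nat.card G := by
  classical
  let _ : Fintype G := Fintype.ofFinite G
  let act : MulSemiringAction G C := MulSemiringAction.compHom C ρ
  have : FaithfulSMul G C := ⟨fun h => hρ (RingHom.ext h)⟩
  have hfix : S = FixedPoints.subfield G C := by
    ext x
    rw [hS]
    rfl
  rw [hfix, Nat.card_eq_fintype_card]
  exact FixedPoints.finrank_eq_card G C

/-- The local degree is the order of the decomposition group. -/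
theorem Place.localDegree_eq_card {E K : Type*} [Field E] [Field K] [Algebra E K] [CharZero K]
    [FiniteDimensional E K] [IsGalois E K] (u : Place K) :
    Place.localDegree E u = Nat.card (MulAction.stabilizer Gal(K/E) u) := by
  classical
  let _ : Fintype (MulAction.stabilizer Gal(K/E) u) := Fintype.ofFinite _
  refine finrank_eq_natCard_of_fixed (decompAction u) ?_ _ ?_
  · intro σ τ h
    apply Subtype.ext
    ext x
    have h1 := congrArg
      (fun f : u.Completion →+* u.Completion => f (WithAbs.toAbs u.rep x : u.Completion)) h
    simp only [decompAction_coe] at h1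
    exact WithAbs.toAbs_injective _ (UniformSpace.Completion.coe_injective _ h1)
  · intro x
    constructor
    · intro hx σ
      have hcl : IsClosed {x : u.Completion | decompAction u σ x = x} :=
        isClosed_eq (decompAction_continuous u σ) continuous_id
      refine hcl.closure_subset_iff.mpr ?_ hx
      rintro _ ⟨y, rfl⟩
      change decompAction u σ (WithAbs.toAbs u.rep (algebraMap E K y) : u.Completion) = _
      rw [decompAction_coe, AlgEquiv.commutes]
      rfl
    · intro hx
      have hcont : Continuous (fun y : u.Completion =>
          ∑ σ : MulAction.stabilizer Gal(K/E) u, decompAction u σ y) :=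
        continuous_finsetSum _ (fun σ _ => decompAction_continuous u σ)
      have hmem : ∀ y : u.Completion, ∑ σ : MulAction.stabilizer Gal(K/E) u,
          decompAction u σ y ∈ (Place.baseSubfield E u).topologicalClosure := by
        intro y
        induction y using UniformSpace.Completion.induction_on with
        | hp => exact (Subfield.isClosed_topologicalClosure _).preimage hcont
        | ih a =>
          have h3 := sum_decomp_mem (E := E) u a.ofAbs
          simp only [← decompAction_coe] at h3
          exact h3
      have h2 := hmem x
      simp only [hx, Finset.sum_const, Finset.card_univ, nsmul_eq_mul] at h2
      let φ : K →+* u.Completion :=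
        (UniformSpace.Completion.coeRingHom : WithAbs u.rep →+* u.Completion).comp
          (WithAbs.equiv u.rep).symm.toRingHom
      have : CharZero u.Completion := charZero_of_injective_ringHom φ.injective
      have hne : ((Fintype.card (MulAction.stabilizer Gal(K/E) u) : ℕ) : u.Completion) ≠ 0 :=
        Nat.cast_ne_zero.mpr Fintype.card_ne_zero
      have h3 := mul_mem (inv_mem (natCast_mem (Place.baseSubfield E u).topologicalClosure
        (Fintype.card (MulAction.stabilizer Gal(K/E) u)))) h2
      rwa [inv_mul_cancel_left₀ hne] at h3

/-! ### Existence of extensions of places -/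

theorem exists_embedding_isEquiv {E C : Type*} [Field E] [NumberField E] [NormedField C]
    [Algebra ℚ C] [IsAlgClosed C] (w : AbsoluteValue E ℝ) (hw : w.IsNontrivial)
    (h : (absComap (algebraMap ℚ E) w).IsEquiv
      (absComap (algebraMap ℚ C) (NormedField.toAbsoluteValue C))) :
    ∃ φ : E →ₐ[ℚ] C, w.IsEquiv (absComap φ.toRingHom (NormedField.toAbsoluteValue C)) := by
  classical
  by_contra! hne
  obtain ⟨c, hc0, hc⟩ := AbsoluteValue.isEquiv_iff_exists_rpow_eq.mp h.symm
  have hc' : ∀ q : ℚ, ‖algebraMap ℚ C q‖ ^ c = w (algebraMap ℚ E q) := fun q => congrFun hc q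
  have hnt : ∀ φ : E →ₐ[ℚ] C,
      (absComap φ.toRingHom (NormedField.toAbsoluteValue C)).IsNontrivial := by
    intro φ
    have h1 : (absComap (algebraMap ℚ C) (NormedField.toAbsoluteValue C)).IsNontrivial := by
      refine h.isNontrivial ?_
      exact absComap_isNontrivial _ (algebraMap_isIntegral_iff.mpr inferInstance) hw
    obtain ⟨q, hq0, hq⟩ := h1
    refine ⟨algebraMap ℚ E q, by simpa using hq0, ?_⟩
    have : φ (algebraMap ℚ E q) = algebraMap ℚ C q := φ.commutes q
    change NormedField.toAbsoluteValue C (φ (algebraMap ℚ E q)) ≠ 1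
    rw [this]
    exact hq
  let _ : Fintype (E →ₐ[ℚ] C) := Fintype.ofFinite _
  let pl : (E →ₐ[ℚ] C) → Place E := fun φ => Place.mk _ (hnt φ)
  let S : Finset (Place E) := insert (Place.mk w hw) (Finset.univ.image pl)
  let ι := {x : Place E // x ∈ S}
  obtain ⟨a, ha1, ha2⟩ := AbsoluteValue.exists_one_lt_lt_one_pi_of_not_isEquiv (R := E) (ι := ι)
    (v := fun i => i.1.rep) (fun i => i.1.rep_isNontrivial) (by
      intro i j hij he
      apply hij
      apply Subtype.ext
      rw [← Place.mk_rep i.1, ← Place.mk_rep j.1, Place.mk_eq_mk]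
      exact he) ⟨Place.mk w hw, Finset.mem_insert_self _ _⟩
  have hwa : 1 < w a := by
    have h1 := Place.mk_rep (Place.mk w hw)
    rw [Place.mk_eq_mk] at h1
    exact h1.one_lt_iff.mp ha1
  have hφa : ∀ φ : E →ₐ[ℚ] C, ‖φ a‖ < 1 := by
    intro φ
    have h1 := Place.mk_rep (pl φ)
    rw [Place.mk_eq_mk] at h1
    refine h1.lt_one_iff.mp (ha2 ⟨pl φ, Finset.mem_insert_of_mem
      (Finset.mem_image_of_mem _ (Finset.mem_univ _))⟩ ?_)
    intro h2
    have h3 : pl φ = Place.mk w hw := congrArg Subtype.val h2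
    rw [Place.mk_eq_mk] at h3
    exact hne φ h3.symm
  -- a uniform bound `r < 1`
  obtain ⟨r, hr0, hr1, hr⟩ : ∃ r : ℝ, 0 ≤ r ∧ r < 1 ∧ ∀ φ : E →ₐ[ℚ] C, ‖φ a‖ ≤ r := by
    let T : Finset ℝ := insert 0 (Finset.univ.image fun φ : E →ₐ[ℚ] C => ‖φ a‖)
    have hT : T.Nonempty := ⟨0, Finset.mem_insert_self _ _⟩
    refine ⟨T.max' hT, T.le_max' _ (Finset.mem_insert_self _ _), ?_, fun φ => T.le_max' _
      (Finset.mem_insert_of_mem (Finset.mem_image_of_mem _ (Finset.mem_univ _)))⟩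
    rw [Finset.max'_lt_iff]
    intro y hy
    rcases Finset.mem_insert.mp hy with rfl | hy
    · exact one_pos
    · obtain ⟨φ, -, rfl⟩ := Finset.mem_image.mp hy
      exact hφa φ
  let n := Module.finrank ℚ E
  -- the coefficients of the minimal polynomials of the powers of `a` tend to zero
  have hbound : ∀ m : ℕ, 1 ≤ n * ((r ^ m * 2 ^ n) ^ c) := by
    intro m
    let b := a ^ m
    let p := minpoly ℚ b
    have hbint : IsIntegral ℚ b := Algebra.IsIntegral.isIntegral b
    have hmon : p.Monic := minpoly.monic hbint
    have hdeg : p.natDegree ≤ n := minpoly.natDegree_le b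
    have hdeg0 : 0 < p.natDegree := minpoly.natDegree_pos hbint
    have hrm1 : r ^ m ≤ 1 := pow_le_one₀ hr0 hr1.le
    have hcoeff : ∀ i < p.natDegree, w (algebraMap ℚ E (p.coeff i)) ≤ (r ^ m * 2 ^ n) ^ c := by
      intro i hi
      rw [← hc']
      refine Real.rpow_le_rpow (norm_nonneg _) ?_ hc0.le
      have h1 := Polynomial.coeff_le_of_roots_le (p := p) (f := algebraMap ℚ C) (B := r ^ m) i hmon
        (IsAlgClosed.splits _) (by
          intro z hz
          have hz' : z ∈ p.rootSet C := by
            rw [Polynomial.mem_rootSet']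
            have hz2 := Polynomial.mem_roots'.mp hz
            refine ⟨hz2.1, ?_⟩
            have h3 := hz2.2
            rwa [Polynomial.IsRoot, Polynomial.eval_map, ← Polynomial.aeval_def] at h3
          rw [← Algebra.IsAlgebraic.range_eval_eq_rootSet_minpoly (F := ℚ) (K := E) (A := C) b] at hz'
          obtain ⟨ψ, rfl⟩ := hz'
          change ‖ψ (a ^ m)‖ ≤ r ^ m
          rw [map_pow, norm_pow]
          exact pow_le_pow_left₀ (norm_nonneg _) (hr ψ) m)
      rw [Polynomial.coeff_map] at h1
      refine h1.trans ?_
      have h2 : (r ^ m) ^ (p.natDegree - i) ≤ r ^ m := by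
        refine pow_le_of_le_one (pow_nonneg hr0 _) hrm1 ?_
        omega
      have h3 : ((p.natDegree.choose i : ℕ) : ℝ) ≤ 2 ^ n := by
        have h4 : p.natDegree.choose i ≤ 2 ^ n :=
          (Nat.choose_le_two_pow _ _).trans (Nat.pow_le_pow_right (by norm_num) hdeg)
        exact_mod_cast h4
      exact mul_le_mul h2 h3 (Nat.cast_nonneg _) (pow_nonneg hr0 _)
    have hwb : 1 ≤ w b := by
      change 1 ≤ w (a ^ m)
      rw [map_pow]
      exact one_le_pow₀ hwa.le
    have hη : 0 ≤ (r ^ m * 2 ^ n) ^ c := Real.rpow_nonneg (by positivity) _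
    have hroot : b ^ p.natDegree =
        -∑ i ∈ Finset.range p.natDegree, algebraMap ℚ E (p.coeff i) * b ^ i := by
      have h1 := minpoly.aeval ℚ b
      change Polynomial.aeval b p = 0 at h1
      rw [Polynomial.aeval_eq_sum_range, Finset.sum_range_succ, hmon.coeff_natDegree, one_smul] at h1
      simp only [Algebra.smul_def] at h1
      exact eq_neg_of_add_eq_zero_right h1
    have hle : w b ^ p.natDegree ≤ n * ((r ^ m * 2 ^ n) ^ c) * w b ^ p.natDegree := by
      calc w b ^ p.natDegree = w (b ^ p.natDegree) := (map_pow _ _ _).symm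
        _ ≤ ∑ i ∈ Finset.range p.natDegree, w (algebraMap ℚ E (p.coeff i) * b ^ i) := by
          rw [hroot, AbsoluteValue.map_neg]; exact w.sum_le _ _
        _ ≤ ∑ i ∈ Finset.range p.natDegree, ((r ^ m * 2 ^ n) ^ c) * w b ^ p.natDegree := by
          refine Finset.sum_le_sum fun i hi => ?_
          have hi' := Finset.mem_range.mp hi
          rw [map_mul, map_pow]
          exact mul_le_mul (hcoeff i hi') (pow_le_pow_right₀ hwb hi'.le)
            (pow_nonneg (w.nonneg _) _) hη
        _ = p.natDegree * (((r ^ m * 2 ^ n) ^ c) * w b ^ p.natDegree) := by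
          rw [Finset.sum_const, Finset.card_range, nsmul_eq_mul]
        _ ≤ n * (((r ^ m * 2 ^ n) ^ c) * w b ^ p.natDegree) := by
          refine mul_le_mul_of_nonneg_right (by exact_mod_cast hdeg) ?_
          exact mul_nonneg hη (pow_nonneg (w.nonneg _) _)
        _ = _ := by ring
    have hpos : 0 < w b ^ p.natDegree := pow_pos (by linarith) _
    by_contra hlt
    push Not at hlt
    nlinarith
  have hlim : Filter.Tendsto (fun m : ℕ => (n : ℝ) * ((r ^ m * 2 ^ n) ^ c)) Filter.atTop (𝓝 0) := by
    have h1 : Filter.Tendsto (fun m : ℕ => r ^ m * 2 ^ n) Filter.atTop (𝓝 (0 * 2 ^ n)) :=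
      (tendsto_pow_atTop_nhds_zero_of_lt_one hr0 hr1).mul_const _
    have h2 := (h1.rpow_const (p := c) (Or.inr hc0.le)).const_mul (n : ℝ)
    rwa [zero_mul, Real.zero_rpow hc0.ne', mul_zero] at h2
  obtain ⟨m, hm⟩ := (hlim.eventually (gt_mem_nhds (zero_lt_one))).exists
  exact absurd (hbound m) (not_le.mpr hm)

/-- Every place of a number field extends to every algebraic extension. -/
theorem Place.under_surjective (E : Type*) {K : Type*} [Field E] [NumberField E] [Field K]
    [Algebra E K] [Algebra.IsAlgebraic E K] :
    Function.Surjective (Place.under E : Place K → Place E) := by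
  have lift : ∀ (C : Type) [NormedField C] [Algebra ℚ C] [IsAlgClosed C]
      (w : AbsoluteValue E ℝ) (hw : w.IsNontrivial),
      (absComap (algebraMap ℚ E) w).IsEquiv
        (absComap (algebraMap ℚ C) (NormedField.toAbsoluteValue C)) →
      ∃ u : Place K, Place.under E u = Place.mk w hw := by
    intro C _ _ _ w hw h
    obtain ⟨φ, hφ⟩ := exists_embedding_isEquiv w hw h
    let _ : Algebra E C := φ.toRingHom.toAlgebra
    let ψ : K →ₐ[E] C := IsAlgClosed.lift
    have hψ : ∀ x : E, ψ (algebraMap E K x) = φ x := fun x => ψ.commutes x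
    have hnt : (absComap ψ.toRingHom (NormedField.toAbsoluteValue C)).IsNontrivial := by
      obtain ⟨x, hx0, hx⟩ := hφ.isNontrivial hw
      refine ⟨algebraMap E K x, by simpa using hx0, ?_⟩
      change NormedField.toAbsoluteValue C (ψ (algebraMap E K x)) ≠ 1
      rw [hψ]
      exact hx
    refine ⟨Place.mk _ hnt, ?_⟩
    refine Place.mk_eq_mk.mpr (AbsoluteValue.IsEquiv.trans ?_ hφ.symm)
    intro x y
    change NormedField.toAbsoluteValue C (ψ (algebraMap E K x)) ≤
      NormedField.toAbsoluteValue C (ψ (algebraMap E K y)) ↔ _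
    rw [hψ, hψ]
    rfl
  intro w
  induction w using Place.ind with
  | h w hw =>
    rcases Rat.AbsoluteValue.equiv_real_or_padic _ (absComap_isNontrivial (algebraMap ℚ E)
      (algebraMap_isIntegral_iff.mpr inferInstance) hw) with h | ⟨p, ⟨hp, h⟩, -⟩
    · refine lift ℂ w hw (h.trans (fun x y => ?_))
      simp [NormedField.toAbsoluteValue]
    · refine lift (PadicAlgCl p) w hw (h.trans (fun x y => ?_))
      have hn : ∀ q : ℚ, ‖algebraMap ℚ (PadicAlgCl p) q‖ = (padicNorm p q : ℝ) := by
        intro q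
        rw [IsScalarTower.algebraMap_apply ℚ ℚ_[p] (PadicAlgCl p)]
        have := PadicAlgCl.norm_extends p (algebraMap ℚ ℚ_[p] q)
        rw [this]
        simp
      simp only [Rat.AbsoluteValue.padic_eq_padicNorm, absComap_apply]
      change _ ↔ ‖algebraMap ℚ (PadicAlgCl p) x‖ ≤ ‖algebraMap ℚ (PadicAlgCl p) y‖
      rw [hn, hn]

/-! ### Fibres of the restriction of places in a Galois extension -/

section Fibres

variable {E K : Type*} [Field E] [Field K] [Algebra E K] [FiniteDimensional E K] [IsGalois E K]

theorem Place.fibre_eq_orbit (u : Place K) :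
    {u' : Place K | Place.under E u' = Place.under E u} = MulAction.orbit Gal(K/E) u := by
  ext u'
  constructor
  · intro h
    obtain ⟨τ, hτ⟩ := Place.exists_smul_eq (E := E) (u := u) (u' := u') h.symm
    exact ⟨τ, hτ⟩
  · rintro ⟨τ, rfl⟩
    exact Place.under_smul_self τ u

theorem Place.fibre_finite (w : Place E) : {u : Place K | Place.under E u = w}.Finite := by
  by_cases h : ∃ u : Place K, Place.under E u = w
  · obtain ⟨u, rfl⟩ := h
    rw [Place.fibre_eq_orbit]
    exact Set.finite_range _
  · push Not at h
    convert Set.finite_empty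
    ext u
    simp [h u]

theorem Place.localDegree_mul_ncard [CharZero K] (u : Place K) :
    Place.localDegree E u * {u' : Place K | Place.under E u' = Place.under E u}.ncard =
      Module.finrank E K := by
  rw [Place.localDegree_eq_card, Place.fibre_eq_orbit, ← IsGalois.card_aut_eq_finrank E K,
    mul_comm, ← Nat.card_coe_set_eq, ← Nat.card_prod,
    Nat.card_congr (MulAction.orbitProdStabilizerEquivGroup Gal(K/E) u)]

theorem Place.localDegree_ne_zero [CharZero K] (u : Place K) : Place.localDegree E u ≠ 0 := by
  intro h
  have h1 := Place.localDegree_mul_ncard (E := E) u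
  rw [h, zero_mul] at h1
  exact Module.finrank_pos.ne h1

end Fibres

/-! ### The finite-level modules -/

section Modules

variable (F E : Type*) [Field F] [Field E] [Algebra F E] [Algebra.IsAlgebraic F E]

/-- The module `M^iso_{E,S} = ℤ[S_E]_0`: finitely supported integral functions on the set of places
of `E` that vanish outside the set `S_E` of places above `S` and whose values add up to zero.
(The group `ℤ` is viewed inside `ℚ`.) -/
def Miso (S : Set (Place F)) : AddSubgroup (Place E →₀ ℚ) where
  carrier := {f | (∀ w, ∃ n : ℤ, f w = n) ∧ (∀ w, Place.under F w ∉ S → f w = 0) ∧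
    (f.sum fun _ q => q) = 0}
  zero_mem' := ⟨fun _ => ⟨0, by simp⟩, fun _ _ => rfl, Finsupp.sum_zero_index⟩
  add_mem' := by
    rintro f g ⟨hf1, hf2, hf3⟩ ⟨hg1, hg2, hg3⟩
    refine ⟨fun w => ?_, fun w hw => ?_, ?_⟩
    · obtain ⟨a, ha⟩ := hf1 w
      obtain ⟨b, hb⟩ := hg1 w
      exact ⟨a + b, by simp [ha, hb]⟩
    · simp [hf2 w hw, hg2 w hw]
    · rw [Finsupp.sum_add_index' (fun _ => rfl) (fun _ _ _ => rfl), hf3, hg3, add_zero]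
  neg_mem' := by
    rintro f ⟨hf1, hf2, hf3⟩
    refine ⟨fun w => ?_, fun w hw => ?_, ?_⟩
    · obtain ⟨a, ha⟩ := hf1 w
      exact ⟨-a, by simp [ha]⟩
    · simp [hf2 w hw]
    · rw [Finsupp.sum_neg_index (fun _ => rfl)]
      simp only [Finsupp.sum, Finset.sum_neg_distrib] at hf3 ⊢
      rw [hf3, neg_zero]

/-- A choice, for every place `v` of `F`, of a place `v̇` of the algebraic extension `L` of `F`
above `v`. -/
structure PlaceLift (L : Type*) [Field L] [Algebra F L] [Algebra.IsAlgebraic F L] where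
  /-- The chosen lift of a place. -/
  lift : Place F → Place L
  under_lift : ∀ v, Place.under F (lift v) = v

variable {F}

/-- The lifts to an intermediate extension `E` induced by lifts to `L`. -/
def PlaceLift.under {L : Type*} [Field L] [Algebra F L] [Algebra.IsAlgebraic F L] [Algebra E L]
    [IsScalarTower F E L] [Algebra.IsAlgebraic E L] (d : PlaceLift F L) : PlaceLift F E where
  lift v := Place.under E (d.lift v)
  under_lift v := by rw [Place.under_under, d.under_lift]

variable {E} [FiniteDimensional F E]

/-- The module `M^mid_{E,Ṡ_E}`, where `Ṡ_E = {v̇ | v ∈ S}` for the chosen lifts `v̇` of the places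
`v` of `F`: finitely supported functions `f : Gal(E/F) × S_E → [E:F]⁻¹ ℤ` such that
`∑_w f(σ,w) = 0`, `∑_σ f(σ,w) ∈ ℤ`, and `f(σ,w) = 0` unless `σ⁻¹ w ∈ Ṡ_E`. -/
def Mmid (d : PlaceLift F E) (S : Set (Place F)) :
    AddSubgroup (Gal(E/F) → Place E →₀ ℚ) where
  carrier := {f | (∀ σ w, ∃ n : ℤ, (Module.finrank F E : ℚ) * f σ w = n) ∧
    (∀ σ, ((f σ).sum fun _ q => q) = 0) ∧ (∀ w, ∃ n : ℤ, ∑ σ, f σ w = n) ∧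
    (∀ σ w, σ⁻¹ • w ∉ d.lift '' S → f σ w = 0)}
  zero_mem' := ⟨fun _ _ => ⟨0, by simp⟩, fun _ => Finsupp.sum_zero_index,
    fun _ => ⟨0, by simp⟩, fun _ _ _ => rfl⟩
  add_mem' := by
    rintro f g ⟨hf1, hf2, hf3, hf4⟩ ⟨hg1, hg2, hg3, hg4⟩
    refine ⟨fun σ w => ?_, fun σ => ?_, fun w => ?_, fun σ w hw => ?_⟩
    · obtain ⟨a, ha⟩ := hf1 σ w
      obtain ⟨b, hb⟩ := hg1 σ w
      exact ⟨a + b, by simp [mul_add, ha, hb]⟩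
    · rw [Pi.add_apply, Finsupp.sum_add_index' (fun _ => rfl) (fun _ _ _ => rfl), hf2, hg2,
        add_zero]
    · obtain ⟨a, ha⟩ := hf3 w
      obtain ⟨b, hb⟩ := hg3 w
      exact ⟨a + b, by simp [Finset.sum_add_distrib, ha, hb]⟩
    · simp [hf4 σ w hw, hg4 σ w hw]
  neg_mem' := by
    rintro f ⟨hf1, hf2, hf3, hf4⟩
    refine ⟨fun σ w => ?_, fun σ => ?_, fun w => ?_, fun σ w hw => ?_⟩
    · obtain ⟨a, ha⟩ := hf1 σ w
      exact ⟨-a, by simp [ha]⟩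
    · have h := hf2 σ
      rw [Pi.neg_apply, Finsupp.sum_neg_index (fun _ => rfl)]
      simp only [Finsupp.sum, Finset.sum_neg_distrib] at h ⊢
      rw [h, neg_zero]
    · obtain ⟨a, ha⟩ := hf3 w
      exact ⟨-a, by simp [ha]⟩
    · simp [hf4 σ w hw]

end Modules

/-! ### Galois action and the map `c^iso` at finite level -/

/-- The translation action of the Galois group on functions on places:
`(τ f)(w) = f(τ⁻¹ w)`. -/
noncomputable def translate {F E : Type*} [Field F] [Field E] [Algebra F E] (τ : Gal(E/F))
    (f : Place E →₀ ℚ) : Place E →₀ ℚ :=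
  f.equivMapDomain (MulAction.toPerm τ)

@[simp] theorem translate_apply {F E : Type*} [Field F] [Field E] [Algebra F E] (τ : Gal(E/F))
    (f : Place E →₀ ℚ) (w : Place E) : translate τ f w = f (τ⁻¹ • w) := rfl

theorem sum_translate {F E : Type*} [Field F] [Field E] [Algebra F E] (τ : Gal(E/F))
    (f : Place E →₀ ℚ) : ((translate τ f).sum fun _ q => q) = f.sum fun _ q => q :=
  Finsupp.sum_equivMapDomain _ _ _

section Modules

variable {F E : Type*} [Field F] [Field E] [Algebra F E] [FiniteDimensional F E]

/-- `(τ f)(w) = f(τ⁻¹ w)` on `M^iso_{E,S}`. -/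
noncomputable instance Miso.distribMulAction (S : Set (Place F)) :
    DistribMulAction Gal(E/F) (Miso F E S) where
  smul τ f := ⟨translate τ f.1, fun w => f.2.1 _, fun w hw => f.2.2.1 _ (by
    change Place.under F (τ⁻¹ • w) ∉ S
    rwa [Place.under_smul_self]), by rw [sum_translate]; exact f.2.2.2⟩
  one_smul f := by
    apply Subtype.ext; ext w
    change f.1 ((1 : Gal(E/F))⁻¹ • w) = f.1 w
    rw [inv_one, one_smul]
  mul_smul σ τ f := by
    apply Subtype.ext; ext w
    change f.1 ((σ * τ)⁻¹ • w) = f.1 (τ⁻¹ • σ⁻¹ • w)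
    rw [mul_inv_rev, mul_smul]
  smul_zero τ := rfl
  smul_add τ f g := by
    apply Subtype.ext; ext w; rfl

theorem Miso.smul_apply {S : Set (Place F)} (τ : Gal(E/F)) (f : Miso F E S) (w : Place E) :
    (τ • f).1 w = f.1 (τ⁻¹ • w) := rfl

/-- `(τ f)(σ,w) = f(τ⁻¹ σ, τ⁻¹ w)` on `M^mid_{E,Ṡ_E}`. -/
noncomputable instance Mmid.distribMulAction (d : PlaceLift F E) (S : Set (Place F)) :
    DistribMulAction Gal(E/F) (Mmid d S) where
  smul τ f := ⟨fun σ => translate τ (f.1 (τ⁻¹ * σ)), fun σ w => f.2.1 _ _,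
    fun σ => by rw [sum_translate]; exact f.2.2.1 _,
    fun w => by
      obtain ⟨n, hn⟩ := f.2.2.2.1 (τ⁻¹ • w)
      refine ⟨n, ?_⟩
      rw [← hn]
      exact Fintype.sum_equiv (Equiv.mulLeft τ⁻¹) _ _ (fun σ => rfl),
    fun σ w hw => f.2.2.2.2 _ _ (by
      change (τ⁻¹ * σ)⁻¹ • τ⁻¹ • w ∉ d.lift '' S
      rwa [mul_inv_rev, inv_inv, mul_smul, smul_inv_smul])⟩
  one_smul f := by
    apply Subtype.ext; funext σ; ext w
    change f.1 ((1 : Gal(E/F))⁻¹ * σ) ((1 : Gal(E/F))⁻¹ • w) = f.1 σ w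
    rw [inv_one, one_smul, one_mul]
  mul_smul σ τ f := by
    apply Subtype.ext; funext ρ; ext w
    change f.1 ((σ * τ)⁻¹ * ρ) ((σ * τ)⁻¹ • w) = f.1 (τ⁻¹ * (σ⁻¹ * ρ)) (τ⁻¹ • σ⁻¹ • w)
    rw [mul_inv_rev, mul_smul, mul_assoc]
  smul_zero τ := rfl
  smul_add τ f g := by
    apply Subtype.ext; funext σ; ext w; rfl

theorem Mmid.smul_apply {d : PlaceLift F E} {S : Set (Place F)} (τ : Gal(E/F)) (f : Mmid d S)
    (σ : Gal(E/F)) (w : Place E) : (τ • f).1 σ w = f.1 (τ⁻¹ * σ) (τ⁻¹ • w) := rfl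

/-- The equivariant map `c^iso : M^mid_{E,Ṡ_E} → M^iso_{E,S}`,
`c^iso(f)(w) = ∑_σ f(σ,w)`. -/
noncomputable def ciso (d : PlaceLift F E) (S : Set (Place F)) :
    Mmid d S →+[Gal(E/F)] Miso F E S where
  toFun f := ⟨∑ σ, f.1 σ, fun w => by
      obtain ⟨n, hn⟩ := f.2.2.2.1 w
      exact ⟨n, by rw [Finsupp.finsetSum_apply, hn]⟩,
    fun w hw => by
      rw [Finsupp.finsetSum_apply]
      refine Finset.sum_eq_zero fun σ _ => f.2.2.2.2 σ w ?_
      rintro ⟨v, hv, hvw⟩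
      apply hw
      rwa [← Place.under_smul_self σ⁻¹ w, ← hvw, d.under_lift],
    by
      rw [← Finsupp.sum_finsetSum_index (fun _ => rfl) (fun _ _ _ => rfl)]
      exact Finset.sum_eq_zero fun σ _ => f.2.2.1 σ⟩
  map_smul' τ f := by
    apply Subtype.ext; ext w
    change (∑ σ, translate τ (f.1 (τ⁻¹ * σ))) w = (∑ σ, f.1 σ) (τ⁻¹ • w)
    rw [Finsupp.finsetSum_apply, Finsupp.finsetSum_apply]
    exact Fintype.sum_equiv (Equiv.mulLeft τ⁻¹) _ _ (fun σ => rfl)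
  map_zero' := by
    apply Subtype.ext
    exact Finset.sum_const_zero
  map_add' f g := by
    apply Subtype.ext
    exact Finset.sum_add_distrib

theorem ciso_apply {d : PlaceLift F E} {S : Set (Place F)} (f : Mmid d S) (w : Place E) :
    (ciso d S f).1 w = ∑ σ, f.1 σ w := Finsupp.finsetSum_apply _ _ _

end Modules

/-! ### Inflation -/

section Inflation

set_option linter.unusedSectionVars false

variable {F E K : Type*} [Field F] [Field E] [Field K] [Algebra F E] [Algebra E K] [Algebra F K]
  [IsScalarTower F E K] [FiniteDimensional F E] [FiniteDimensional F K] [FiniteDimensional E K]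
  [IsGalois F E] [IsGalois F K] [IsGalois E K]

theorem inflIso_finite (f : Place E →₀ ℚ) : {u : Place K | f (Place.under E u) ≠ 0}.Finite := by
  have : {u : Place K | f (Place.under E u) ≠ 0} ⊆
      ⋃ w ∈ (f.support : Set (Place E)), {u : Place K | Place.under E u = w} := by
    intro u hu
    simp only [Set.mem_iUnion]
    exact ⟨Place.under E u, by simpa using hu, rfl⟩
  exact (Set.Finite.biUnion f.support.finite_toSet fun w _ => Place.fibre_finite w).subset this

/-- The function `u ↦ [K_u : E_w] f(w)`, where `w` is the place of `E` under `u`. -/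
noncomputable def inflIsoFun (K : Type*) [Field K] [Algebra E K] [FiniteDimensional E K]
    [IsGalois E K] (f : Place E →₀ ℚ) : Place K →₀ ℚ :=
  Finsupp.ofSupportFinite (fun u => Place.localDegree E u * f (Place.under E u))
    ((inflIso_finite f).subset fun _ hu => right_ne_zero_of_mul hu)

theorem inflIsoFun_apply (f : Place E →₀ ℚ) (u : Place K) :
    inflIsoFun K f u = Place.localDegree E u * f (Place.under E u) := rfl

theorem sum_inflIsoFun [NumberField E] [CharZero K] (f : Place E →₀ ℚ) :
    ((inflIsoFun K f).sum fun _ q => q) = Module.finrank E K * f.sum fun _ q => q := by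
  classical
  unfold Finsupp.sum
  rw [← Finset.sum_fiberwise_of_maps_to (t := f.support) (g := Place.under E), Finset.mul_sum]
  · refine Finset.sum_congr rfl fun w hw => ?_
    obtain ⟨u₀, rfl⟩ := Place.under_surjective E (K := K) w
    have hw' : f (Place.under E u₀) ≠ 0 := by simpa using hw
    have hfib : (inflIsoFun K f).support.filter (fun u => Place.under E u = Place.under E u₀) =
        (Place.fibre_finite (K := K) (Place.under E u₀)).toFinset := by
      ext u
      simp only [Finset.mem_filter, Finsupp.mem_support_iff, Set.Finite.mem_toFinset,
        Set.mem_ofPred_eq, and_iff_right_iff_imp]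
      intro hu
      rw [inflIsoFun_apply, hu]
      exact mul_ne_zero (Nat.cast_ne_zero.mpr (Place.localDegree_ne_zero u)) hw'
    rw [hfib]
    have hdeg : ∀ u ∈ (Place.fibre_finite (K := K) (Place.under E u₀)).toFinset,
        inflIsoFun K f u = Place.localDegree E u₀ * f (Place.under E u₀) := by
      intro u hu
      have hu' : Place.under E u = Place.under E u₀ := by simpa using hu
      rw [inflIsoFun_apply, hu']
      have h1 := Place.localDegree_mul_ncard (E := E) u
      have h2 := Place.localDegree_mul_ncard (E := E) u₀
      rw [hu', ← h2] at h1
      have h3 : {u' : Place K | Place.under E u' = Place.under E u₀}.ncard ≠ 0 := by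
        intro h4
        rw [h4, mul_zero] at h2
        exact Module.finrank_pos.ne h2
      rw [Nat.eq_of_mul_eq_mul_right (Nat.pos_of_ne_zero h3) h1]
    rw [Finset.sum_congr rfl hdeg, Finset.sum_const, nsmul_eq_mul, ← mul_assoc,
      ← Place.localDegree_mul_ncard (E := E) u₀, Nat.cast_mul,
      Set.ncard_eq_toFinset_card _ (Place.fibre_finite (K := K) (Place.under E u₀))]
    ring
  · intro u hu
    rw [Finsupp.mem_support_iff, inflIsoFun_apply] at hu
    exact Finsupp.mem_support_iff.mpr (right_ne_zero_of_mul hu)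

theorem Place.localDegree_smul [CharZero K] (σ : Gal(K/F)) (u : Place K) :
    Place.localDegree E (σ • u) = Place.localDegree E u := by
  have h1 := Place.localDegree_mul_ncard (E := E) u
  have h2 := Place.localDegree_mul_ncard (E := E) (σ • u)
  have h3 : {u' : Place K | Place.under E u' = Place.under E (σ • u)} =
      (fun x => σ • x) '' {u' : Place K | Place.under E u' = Place.under E u} := by
    ext x
    constructor
    · intro hx
      refine ⟨σ⁻¹ • x, ?_, smul_inv_smul _ _⟩
      have hx' : Place.under E x = Place.under E (σ • u) := hx
      change Place.under E (σ⁻¹ • x) = Place.under E u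
      rw [Place.under_smul, hx', ← Place.under_smul, inv_smul_smul]
    · rintro ⟨y, hy, rfl⟩
      have hy' : Place.under E y = Place.under E u := hy
      change Place.under E (σ • y) = Place.under E (σ • u)
      rw [Place.under_smul, hy', ← Place.under_smul]
  rw [h3, Set.ncard_image_of_injective _ (MulAction.injective σ), ← h1] at h2
  refine Nat.eq_of_mul_eq_mul_right (Nat.pos_of_ne_zero fun h4 => ?_) h2
  rw [h4, mul_zero] at h1
  exact Module.finrank_pos.ne h1

/-- The inflation map `M^iso_{E,S} → M^iso_{K,S'}`, `S ⊆ S'`, given by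
`f ↦ (u ↦ [K_u : E_w] f(w))`, where `w` is the place of `E` under `u`. -/
noncomputable def inflIso [NumberField E] [CharZero K] {S S' : Set (Place F)} (hS : S ⊆ S') :
    Miso F E S →+ Miso F K S' where
  toFun f := ⟨inflIsoFun K f.1, fun u => by
      obtain ⟨n, hn⟩ := f.2.1 (Place.under E u)
      exact ⟨Place.localDegree E u * n, by rw [inflIsoFun_apply, hn]; push_cast; rfl⟩,
    fun u hu => by
      rw [inflIsoFun_apply, f.2.2.1 _ (fun h => hu (hS ?_)), mul_zero]
      rwa [Place.under_under] at h,
    by rw [sum_inflIsoFun, f.2.2.2, mul_zero]⟩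
  map_zero' := by
    apply Subtype.ext; ext u
    change (Place.localDegree E u : ℚ) * (0 : ℚ) = 0
    rw [mul_zero]
  map_add' f g := by
    apply Subtype.ext; ext u
    change (Place.localDegree E u : ℚ) * (f.1 _ + g.1 _) =
      (Place.localDegree E u : ℚ) * f.1 _ + (Place.localDegree E u : ℚ) * g.1 _
    rw [mul_add]

theorem inflIso_apply [NumberField E] [CharZero K] {S S' : Set (Place F)} (hS : S ⊆ S')
    (f : Miso F E S) (u : Place K) :
    (inflIso hS f : Miso F K S').1 u = Place.localDegree E u * f.1 (Place.under E u) := rfl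

theorem inflIso_smul [NumberField E] [CharZero K] {S S' : Set (Place F)} (hS : S ⊆ S')
    (f : Miso F E S) (σ : Gal(K/F)) :
    (inflIso hS (AlgEquiv.restrictNormalHom E σ • f) : Miso F K S') = σ • inflIso hS f := by
  apply Subtype.ext; ext u
  rw [Miso.smul_apply, inflIso_apply, inflIso_apply, Miso.smul_apply, Place.localDegree_smul,
    Place.under_smul, map_inv]

open Classical in
/-- The function `(σ,u) ↦ f(σ|_E, w)` if `σ⁻¹ u ∈ Ṡ_K` and `0` otherwise, where `w` is the place
of `E` under `u`. -/
noncomputable def inflMidFun (d : PlaceLift F K) (S : Set (Place F))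
    (f : Gal(E/F) → Place E →₀ ℚ) : Gal(K/F) → Place K →₀ ℚ := fun σ =>
  Finsupp.ofSupportFinite (fun u => if σ⁻¹ • u ∈ d.lift '' S then
      f (AlgEquiv.restrictNormalHom E σ) (Place.under E u) else 0)
    ((inflIso_finite (f (AlgEquiv.restrictNormalHom E σ))).subset fun u hu => by
      by_contra h
      exact hu (by simp only [Set.mem_ofPred_eq, not_not] at h; simp [h]))

open Classical in
theorem inflMidFun_apply (d : PlaceLift F K) (S : Set (Place F))
    (f : Gal(E/F) → Place E →₀ ℚ) (σ : Gal(K/F)) (u : Place K) :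
    inflMidFun d S f σ u = if σ⁻¹ • u ∈ d.lift '' S then
      f (AlgEquiv.restrictNormalHom E σ) (Place.under E u) else 0 := rfl

theorem sum_inflMidFun (d : PlaceLift F K) {S : Set (Place F)} (f : Mmid (d.under E) S)
    (σ : Gal(K/F)) : ((inflMidFun d S f.1 σ).sum fun _ q => q) = 0 := by
  classical
  rw [← f.2.2.1 (AlgEquiv.restrictNormalHom E σ)]
  have hlift : ∀ w, f.1 (AlgEquiv.restrictNormalHom E σ) w ≠ 0 →
      Place.under F w ∈ S ∧ w = Place.under E (σ • d.lift (Place.under F w)) := by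
    intro w hw
    by_cases h : (AlgEquiv.restrictNormalHom E σ)⁻¹ • w ∈ (d.under E).lift '' S
    · obtain ⟨v, hv, hvw⟩ := h
      have h1 : w = Place.under E (σ • d.lift v) := by
        rw [Place.under_smul]
        exact (inv_smul_eq_iff.mp hvw.symm)
      have h2 : Place.under F w = v := by
        rw [h1, Place.under_under, Place.under_smul_self, d.under_lift]
      rw [h2]
      exact ⟨hv, h1⟩
    · exact absurd (f.2.2.2.2 _ _ h) hw
  unfold Finsupp.sum
  refine Finset.sum_bij' (fun u _ => Place.under E u)
    (fun w _ => σ • d.lift (Place.under F w)) ?_ ?_ ?_ ?_ ?_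
  · intro u hu
    rw [Finsupp.mem_support_iff, inflMidFun_apply] at hu
    rw [Finsupp.mem_support_iff]
    intro h
    rw [h] at hu
    simp at hu
  · intro w hw
    rw [Finsupp.mem_support_iff] at hw
    obtain ⟨h1, h2⟩ := hlift w hw
    rw [Finsupp.mem_support_iff, inflMidFun_apply, inv_smul_smul, ← h2,
      if_pos (Set.mem_image_of_mem _ h1)]
    exact hw
  · intro u hu
    rw [Finsupp.mem_support_iff, inflMidFun_apply] at hu
    have h1 : σ⁻¹ • u ∈ d.lift '' S := by
      by_contra h
      exact hu (if_neg h)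
    obtain ⟨v, hv, hvu⟩ := h1
    have h2 : u = σ • d.lift v := inv_smul_eq_iff.mp hvu.symm
    rw [Place.under_under, h2, Place.under_smul_self, d.under_lift]
  · intro w hw
    rw [Finsupp.mem_support_iff] at hw
    exact (hlift w hw).2.symm
  · intro u hu
    rw [Finsupp.mem_support_iff, inflMidFun_apply] at hu
    rw [inflMidFun_apply]
    have h1 : σ⁻¹ • u ∈ d.lift '' S := by
      by_contra h
      exact hu (if_neg h)
    rw [if_pos h1]

/-- The number of lifts `σ` of `ρ` such that `σ⁻¹ u` is a given place is the local degree. -/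
theorem card_lifts [CharZero K] (ρ : Gal(E/F)) (u u₀ : Place K)
    (h : Place.under E u₀ = ρ⁻¹ • Place.under E u) :
    Nat.card {σ : Gal(K/F) // AlgEquiv.restrictNormalHom E σ = ρ ∧ σ⁻¹ • u = u₀} =
      Place.localDegree E u := by
  rw [Place.localDegree_eq_card]
  have hker : ∀ τ : Gal(K/E),
      AlgEquiv.restrictNormalHom E (AlgEquiv.restrictScalars F τ : Gal(K/F)) = 1 := by
    intro τ
    ext x
    apply (algebraMap E K).injective
    have h1 := AlgEquiv.restrictNormal_commutes (AlgEquiv.restrictScalars F τ : Gal(K/F)) E x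
    exact h1.trans (τ.commutes x)
  -- one lift
  obtain ⟨σ₁, hσ₁⟩ := AlgEquiv.restrictNormalHom_surjective (F := F) (K₁ := E) K ρ
  have h1 : Place.under E (σ₁⁻¹ • u) = Place.under E u₀ := by
    rw [Place.under_smul, map_inv, hσ₁, h]
  obtain ⟨τ, hτ⟩ := Place.exists_smul_eq h1
  set σ₀ : Gal(K/F) := σ₁ * (AlgEquiv.restrictScalars F τ : Gal(K/F))⁻¹ with hσ₀
  have hr : AlgEquiv.restrictNormalHom E σ₀ = ρ := by
    rw [hσ₀, map_mul, map_inv, hker, inv_one, mul_one, hσ₁]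
  have hu : σ₀⁻¹ • u = u₀ := by
    rw [hσ₀, mul_inv_rev, inv_inv, mul_smul, Place.restrictScalars_smul, hτ]
  have hu' : σ₀ • u₀ = u := by rw [← hu, smul_inv_smul]
  symm
  refine Nat.card_eq_of_bijective (fun g : MulAction.stabilizer Gal(K/E) u =>
    (⟨(AlgEquiv.restrictScalars F g.1 : Gal(K/F)) * σ₀, by rw [map_mul, hker, one_mul, hr], by
      rw [inv_smul_eq_iff, mul_smul, hu', Place.restrictScalars_smul]
      exact g.2.symm⟩ :
      {σ : Gal(K/F) // AlgEquiv.restrictNormalHom E σ = ρ ∧ σ⁻¹ • u = u₀})) ⟨?_, ?_⟩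
  · intro g g' hgg
    have h2 := mul_right_cancel (congrArg Subtype.val hgg)
    apply Subtype.ext
    ext x
    exact DFunLike.congr_fun h2 x
  · rintro ⟨σ, hσr, hσu⟩
    have h2 : AlgEquiv.restrictNormalHom E (σ * σ₀⁻¹) = 1 := by
      rw [map_mul, map_inv, hσr, hr, mul_inv_cancel]
    have h3 : ∀ x : E, (σ * σ₀⁻¹) (algebraMap E K x) = algebraMap E K x := by
      intro x
      have h4 := AlgEquiv.restrictNormal_commutes (σ * σ₀⁻¹) E x
      have h5 : (σ * σ₀⁻¹).restrictNormal E = 1 := h2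
      rw [h5] at h4
      exact h4.symm
    let g : Gal(K/E) := AlgEquiv.ofRingEquiv (f := (σ * σ₀⁻¹).toRingEquiv) h3
    have hg : (AlgEquiv.restrictScalars F g : Gal(K/F)) = σ * σ₀⁻¹ := by
      ext x; rfl
    have hgs : g • u = u := by
      rw [← Place.restrictScalars_smul F, hg, mul_smul, hu, ← hσu, smul_inv_smul]
    refine ⟨⟨g, hgs⟩, ?_⟩
    apply Subtype.ext
    change (AlgEquiv.restrictScalars F g : Gal(K/F)) * σ₀ = σ
    rw [hg, inv_mul_cancel_right]

theorem sum_gal_inflMidFun [CharZero K] (d : PlaceLift F K) {S : Set (Place F)}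
    (f : Mmid (d.under E) S) (u : Place K) :
    ∑ σ, inflMidFun d S f.1 σ u = Place.localDegree E u * ∑ ρ, f.1 ρ (Place.under E u) := by
  classical
  rw [← Finset.sum_fiberwise (s := Finset.univ) (g := fun σ : Gal(K/F) =>
    AlgEquiv.restrictNormalHom E σ), Finset.mul_sum]
  refine Finset.sum_congr rfl fun ρ _ => ?_
  by_cases hf : f.1 ρ (Place.under E u) = 0
  · rw [hf, mul_zero]
    refine Finset.sum_eq_zero fun σ hσ => ?_
    have hσ' : AlgEquiv.restrictNormalHom E σ = ρ := by simpa using hσ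
    rw [inflMidFun_apply, hσ', hf, ite_self]
  · have hmem : ρ⁻¹ • Place.under E u ∈ (d.under E).lift '' S := by
      by_contra h
      exact hf (f.2.2.2.2 _ _ h)
    obtain ⟨v, hv, hvu⟩ := hmem
    have hvu' : Place.under E (d.lift v) = ρ⁻¹ • Place.under E u := hvu
    have hvF : v = Place.under F u := by
      rw [← Place.under_under F E u, ← Place.under_smul_self ρ⁻¹, ← hvu', Place.under_under,
        d.under_lift]
    rw [← card_lifts ρ u (d.lift v) hvu', Nat.card_eq_fintype_card, Fintype.card_subtype,
      ← nsmul_eq_mul, ← Finset.sum_const]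
    have hset : Finset.univ.filter (fun σ : Gal(K/F) =>
        AlgEquiv.restrictNormalHom E σ = ρ ∧ σ⁻¹ • u = d.lift v) =
        (Finset.univ.filter (fun σ : Gal(K/F) => AlgEquiv.restrictNormalHom E σ = ρ)).filter
          (fun σ => σ⁻¹ • u ∈ d.lift '' S) := by
      rw [Finset.filter_filter]
      refine Finset.filter_congr fun σ _ => and_congr_right fun _ => ?_
      constructor
      · intro h
        exact ⟨v, hv, h.symm⟩
      · rintro ⟨v', -, hv'⟩
        have h1 : v' = Place.under F u := by
          rw [← d.under_lift v', hv', Place.under_smul_self]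
        rw [← hv', h1, hvF]
    rw [hset, Finset.sum_filter (fun σ : Gal(K/F) => σ⁻¹ • u ∈ d.lift '' S)]
    refine Finset.sum_congr rfl fun σ hσ => ?_
    have hσ' : AlgEquiv.restrictNormalHom E σ = ρ := by simpa using hσ
    rw [inflMidFun_apply, hσ']

theorem inflMidFun_mem [CharZero K] (d : PlaceLift F K) {e : PlaceLift F E} (he : d.under E = e)
    {S S' : Set (Place F)} (hS : S ⊆ S') (f : Mmid e S) : inflMidFun d S f.1 ∈ Mmid d S' := by
  subst he
  refine ⟨fun σ u => ?_, sum_inflMidFun d f, fun u => ?_, fun σ u hu => ?_⟩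
  · rw [inflMidFun_apply]
    split_ifs
    · obtain ⟨n, hn⟩ := f.2.1 (AlgEquiv.restrictNormalHom E σ) (Place.under E u)
      refine ⟨Module.finrank E K * n, ?_⟩
      rw [← Module.finrank_mul_finrank F E K]
      push_cast
      rw [← hn]
      ring
    · exact ⟨0, by simp⟩
  · obtain ⟨n, hn⟩ := f.2.2.2.1 (Place.under E u)
    exact ⟨Place.localDegree E u * n, by rw [sum_gal_inflMidFun, hn]; push_cast; rfl⟩
  · rw [inflMidFun_apply, if_neg (fun h => hu (Set.image_mono hS h))]

/-- The inflation map `M^mid_{E,Ṡ_E} → M^mid_{K,Ṡ'_K}`, `S ⊆ S'`, given by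
`f ↦ ((σ,u) ↦ f(σ|_E, w))` if `σ⁻¹ u ∈ Ṡ_K` and `0` otherwise; the lifts of places to `E` are
the restrictions of the lifts to `K`. -/
noncomputable def inflMid [CharZero K] (d : PlaceLift F K) {e : PlaceLift F E}
    (he : d.under E = e) {S S' : Set (Place F)} (hS : S ⊆ S') : Mmid e S →+ Mmid d S' where
  toFun f := ⟨inflMidFun d S f.1, inflMidFun_mem d he hS f⟩
  map_zero' := by
    apply Subtype.ext; funext σ; ext u
    exact ite_self _
  map_add' f g := by
    apply Subtype.ext; funext σ; ext u
    change inflMidFun d S (f.1 + g.1) σ u = inflMidFun d S f.1 σ u + inflMidFun d S g.1 σ u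
    rw [inflMidFun_apply, inflMidFun_apply, inflMidFun_apply]
    split_ifs
    · rfl
    · rw [add_zero]

theorem inflMid_val [CharZero K] (d : PlaceLift F K) {e : PlaceLift F E}
    (he : d.under E = e) {S S' : Set (Place F)} (hS : S ⊆ S') (f : Mmid e S) :
    (inflMid d he hS f : Mmid d S').1 = inflMidFun d S f.1 := rfl

theorem inflMid_smul [CharZero K] (d : PlaceLift F K) {e : PlaceLift F E}
    (he : d.under E = e) {S S' : Set (Place F)} (hS : S ⊆ S') (f : Mmid e S) (τ : Gal(K/F)) :
    (inflMid d he hS (AlgEquiv.restrictNormalHom E τ • f) : Mmid d S') =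
      τ • inflMid d he hS f := by
  apply Subtype.ext; funext σ; ext u
  rw [Mmid.smul_apply, inflMid_val, inflMid_val, inflMidFun_apply, inflMidFun_apply,
    Mmid.smul_apply, Place.under_smul, map_mul, map_inv, mul_inv_rev, inv_inv, mul_smul,
    smul_inv_smul]

/-- Compatibility of `c^iso` with inflation. -/
theorem ciso_inflMid [NumberField E] [CharZero K] (d : PlaceLift F K) {e : PlaceLift F E}
    (he : d.under E = e) {S S' : Set (Place F)} (hS : S ⊆ S') (f : Mmid e S) :
    ciso d S' (inflMid d he hS f) = inflIso hS (ciso e S f) := by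
  subst he
  apply Subtype.ext; ext u
  rw [ciso_apply, inflIso_apply, ciso_apply, inflMid_val, sum_gal_inflMidFun]

end Inflation

/-! ### Inflation for finite Galois subextensions of an algebraic closure -/

section Tower

set_option linter.unusedSectionVars false

variable {F Fbar : Type*} [Field F] [NumberField F] [Field Fbar] [Algebra F Fbar]
  [Algebra.IsAlgebraic F Fbar]

/-- The inflation map `M^iso_{E,S} → M^iso_{K,S'}` for `E ≤ K` and `S ⊆ S'`. -/
noncomputable def towerInflIso {E K : FiniteGaloisIntermediateField F Fbar} (h : E ≤ K)
    {S S' : Set (Place F)} (hS : S ⊆ S') : Miso F E S →+ Miso F K S' :=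
  letI : Algebra E K := (IntermediateField.inclusion h).toRingHom.toAlgebra
  haveI : IsScalarTower F E K := IsScalarTower.of_algebraMap_eq' rfl
  haveI : FiniteDimensional E K := FiniteDimensional.right F E K
  haveI : IsGalois E K := IsGalois.tower_top_of_isGalois F E K
  haveI : NumberField E := NumberField.of_module_finite F E
  haveI : CharZero K := charZero_of_injective_algebraMap (algebraMap F K).injective
  inflIso hS

/-- The inflation map `M^mid_{E,Ṡ_E} → M^mid_{K,Ṡ'_K}` for `E ≤ K` and `S ⊆ S'`, with respect to
the lifts of places of `F` induced by a choice of lifts to the algebraic closure. -/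
noncomputable def towerInflMid (V : PlaceLift F Fbar) {E K : FiniteGaloisIntermediateField F Fbar}
    (h : E ≤ K) {S S' : Set (Place F)} (hS : S ⊆ S') :
    Mmid (V.under E) S →+ Mmid (V.under K) S' :=
  letI : Algebra E K := (IntermediateField.inclusion h).toRingHom.toAlgebra
  haveI : IsScalarTower F E K := IsScalarTower.of_algebraMap_eq' rfl
  haveI : IsScalarTower E K Fbar := IsScalarTower.of_algebraMap_eq' rfl
  haveI : FiniteDimensional E K := FiniteDimensional.right F E K
  haveI : IsGalois E K := IsGalois.tower_top_of_isGalois F E K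
  haveI : CharZero K := charZero_of_injective_algebraMap (algebraMap F K).injective
  inflMid (V.under K)
    (by simp only [PlaceLift.under, Place.under_under]) hS

theorem restrictNormalHom_restrictNormalHom {E K : FiniteGaloisIntermediateField F Fbar}
    [Algebra E K] [IsScalarTower F E K] [IsScalarTower E K Fbar] (σ : Gal(Fbar/F)) :
    AlgEquiv.restrictNormalHom E (AlgEquiv.restrictNormalHom K σ) =
      AlgEquiv.restrictNormalHom E σ :=
  (IsScalarTower.AlgEquiv.restrictNormalHom_comp_apply E K σ).symm

theorem ciso_towerInflMid (V : PlaceLift F Fbar) {E K : FiniteGaloisIntermediateField F Fbar}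
    (h : E ≤ K) {S S' : Set (Place F)} (hS : S ⊆ S')
    (f : Mmid (V.under E) S) :
    ciso _ S' (towerInflMid V h hS f) = towerInflIso h hS (ciso _ S f) := by
  let _ : Algebra E K := (IntermediateField.inclusion h).toRingHom.toAlgebra
  have : IsScalarTower F E K := IsScalarTower.of_algebraMap_eq' rfl
  have : FiniteDimensional E K := FiniteDimensional.right F E K
  have : IsGalois E K := IsGalois.tower_top_of_isGalois F E K
  have : NumberField E := NumberField.of_module_finite F E
  have : CharZero K := charZero_of_injective_algebraMap (algebraMap F K).injective
  exact ciso_inflMid _ _ hS f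

/-- The absolute Galois group acts on the modules at level `E` through `Gal(E/F)`. -/
noncomputable instance (E : FiniteGaloisIntermediateField F Fbar) (S : Set (Place F)) :
    DistribMulAction Gal(Fbar/F) (Miso F E S) :=
  DistribMulAction.compHom _ (AlgEquiv.restrictNormalHom (F := F) (K₁ := Fbar) E)

noncomputable instance (E : FiniteGaloisIntermediateField F Fbar) (d : PlaceLift F E)
    (S : Set (Place F)) : DistribMulAction Gal(Fbar/F) (Mmid d S) :=
  DistribMulAction.compHom _ (AlgEquiv.restrictNormalHom (F := F) (K₁ := Fbar) E)

theorem ciso_gal_smul {E : FiniteGaloisIntermediateField F Fbar} (d : PlaceLift F E)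
    (S : Set (Place F)) (σ : Gal(Fbar/F)) (f : Mmid d S) :
    ciso d S (σ • f) = σ • ciso d S f :=
  map_smul (ciso d S) (AlgEquiv.restrictNormalHom (F := F) (K₁ := Fbar) E σ) f

theorem towerInflIso_smul {E K : FiniteGaloisIntermediateField F Fbar} (h : E ≤ K)
    {S S' : Set (Place F)} (hS : S ⊆ S') (σ : Gal(Fbar/F)) (f : Miso F E S) :
    towerInflIso h hS (σ • f) = σ • towerInflIso h hS f := by
  let _ : Algebra E K := (IntermediateField.inclusion h).toRingHom.toAlgebra
  have : IsScalarTower F E K := IsScalarTower.of_algebraMap_eq' rfl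
  have : IsScalarTower E K Fbar := IsScalarTower.of_algebraMap_eq' rfl
  have : FiniteDimensional E K := FiniteDimensional.right F E K
  have : IsGalois E K := IsGalois.tower_top_of_isGalois F E K
  have : NumberField E := NumberField.of_module_finite F E
  have : CharZero K := charZero_of_injective_algebraMap (algebraMap F K).injective
  have h1 := inflIso_smul (K := K) hS f (AlgEquiv.restrictNormalHom K σ)
  rw [restrictNormalHom_restrictNormalHom] at h1
  exact h1

theorem towerInflMid_smul (V : PlaceLift F Fbar) {E K : FiniteGaloisIntermediateField F Fbar}
    (h : E ≤ K) {S S' : Set (Place F)} (hS : S ⊆ S') (σ : Gal(Fbar/F))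
    (f : Mmid (V.under E) S) :
    towerInflMid V h hS (σ • f) = σ • towerInflMid V h hS f := by
  let _ : Algebra E K := (IntermediateField.inclusion h).toRingHom.toAlgebra
  have : IsScalarTower F E K := IsScalarTower.of_algebraMap_eq' rfl
  have : IsScalarTower E K Fbar := IsScalarTower.of_algebraMap_eq' rfl
  have : FiniteDimensional E K := FiniteDimensional.right F E K
  have : IsGalois E K := IsGalois.tower_top_of_isGalois F E K
  have : CharZero K := charZero_of_injective_algebraMap (algebraMap F K).injective
  have h1 := inflMid_smul (V.under K) (E := E) (e := V.under E)
    (by simp only [PlaceLift.under, Place.under_under]) hS f (AlgEquiv.restrictNormalHom K σ)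
  rw [restrictNormalHom_restrictNormalHom] at h1
  exact h1

end Tower

/-! ### Groups of multiplicative type and their inverse limits -/

section ProTori

open CategoryTheory

variable {F : Type u} (Fbar : Type u) [Field F] [Field Fbar] [Algebra F Fbar]

/-- The automorphism of `R ⊗ F̄` induced by an element of the Galois group. -/
noncomputable def galTensor (R : Type u) [CommRing R] [Algebra F R] (σ : Gal(Fbar/F)) :
    R ⊗[F] Fbar →ₐ[F] R ⊗[F] Fbar :=
  Algebra.TensorProduct.map (AlgHom.id F R) σ.toAlgHom

/-- The `R`-points of the group of multiplicative type over `F` with character module `M`: the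
Galois-equivariant homomorphisms `M → (R ⊗ F̄)ˣ`. -/
noncomputable def multPoints (M : Type u) [AddCommGroup M] [DistribMulAction Gal(Fbar/F) M]
    (R : Type u) [CommRing R] [Algebra F R] : Subgroup (Multiplicative M →* (R ⊗[F] Fbar)ˣ) where
  carrier := {χ | ∀ (σ : Gal(Fbar/F)) (m : M), χ (Multiplicative.ofAdd (σ • m)) =
    Units.map (galTensor Fbar R σ).toRingHom.toMonoidHom (χ (Multiplicative.ofAdd m))}
  one_mem' σ m := by simp
  mul_mem' {χ ψ} hχ hψ σ m := by
    rw [MonoidHom.mul_apply, MonoidHom.mul_apply, hχ, hψ, map_mul]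
  inv_mem' {χ} hχ σ m := by
    rw [MonoidHom.inv_apply, MonoidHom.inv_apply, hχ, map_inv]

variable (F) in
/-- The index set of the inverse systems: pairs `(E,S)` of a finite Galois subextension `E/F` of
`F̄/F` and a finite set `S` of places of `F`. -/
abbrev Level : Type u := FiniteGaloisIntermediateField F Fbar × Finset (Place F)

variable (F) in
/-- A family of Galois modules, indexed by the pairs `(E,S)`, with equivariant transition maps. -/
structure CharacterSystem where
  /-- The module at level `(E,S)`. -/
  M : Level F Fbar → Type u
  [addCommGroup : ∀ i, AddCommGroup (M i)]
  [action : ∀ i, DistribMulAction Gal(Fbar/F) (M i)]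
  /-- The transition maps. -/
  infl : ∀ {i j}, i ≤ j → M i →+[Gal(Fbar/F)] M j

attribute [instance] CharacterSystem.addCommGroup CharacterSystem.action

variable {Fbar}

/-- The `R`-points of the inverse limit of the groups of multiplicative type with character
modules `X.M i`: compatible families of points. -/
noncomputable def limPoints (X : CharacterSystem F Fbar) (R : Type u) [CommRing R] [Algebra F R] :
    Subgroup (∀ i, multPoints (F := F) Fbar (X.M i) R) where
  carrier := {t | ∀ {i j} (h : i ≤ j) (m : X.M i),
    (t j).1 (Multiplicative.ofAdd (X.infl h m)) = (t i).1 (Multiplicative.ofAdd m)}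
  one_mem' _ _ := rfl
  mul_mem' hs ht _ _ h m := congrArg₂ (· * ·) (hs h m) (ht h m)
  inv_mem' ht _ _ h m := congrArg (·⁻¹) (ht h m)

/-- Functoriality of `limPoints` in the `F`-algebra. -/
noncomputable def limPointsMap (X : CharacterSystem F Fbar) {R R' : Type u} [CommRing R]
    [Algebra F R] [CommRing R'] [Algebra F R'] (φ : R →ₐ[F] R') :
    limPoints X R →* limPoints X R' where
  toFun t := ⟨fun i => ⟨(Units.map
      (Algebra.TensorProduct.map φ (AlgHom.id F Fbar)).toRingHom.toMonoidHom).comp (t.1 i).1,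
      fun σ m => by
        have h1 := (t.1 i).2 σ m
        rw [MonoidHom.comp_apply, h1, MonoidHom.comp_apply]
        ext
        have h2 : ((Algebra.TensorProduct.map φ (AlgHom.id F Fbar)).comp (galTensor Fbar R σ)) =
            (galTensor Fbar R' σ).comp (Algebra.TensorProduct.map φ (AlgHom.id F Fbar)) := by
          apply Algebra.TensorProduct.ext <;> ext <;> simp [galTensor]
        exact DFunLike.congr_fun h2 _⟩,
    fun h m => congrArg (Units.map
      (Algebra.TensorProduct.map φ (AlgHom.id F Fbar)).toRingHom.toMonoidHom) (t.2 h m)⟩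
  map_one' := by
    apply Subtype.ext; funext i; apply Subtype.ext; ext m
    exact map_one (Algebra.TensorProduct.map φ (AlgHom.id F Fbar))
  map_mul' s t := by
    apply Subtype.ext; funext i; apply Subtype.ext; ext m
    exact map_mul (Algebra.TensorProduct.map φ (AlgHom.id F Fbar)) _ _

/-- The inverse limit of the groups of multiplicative type with character modules `X.M i`, as a
functor from commutative `F`-algebras to groups. -/
noncomputable def proGroup (X : CharacterSystem F Fbar) : CommAlgCat.{u} F ⥤ CommGrpCat.{u} where
  obj R := CommGrpCat.of (limPoints X R)
  map φ := CommGrpCat.ofHom (limPointsMap X φ.hom)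
  map_id R := by
    ext t i m
    change Algebra.TensorProduct.map (AlgHom.id F R) (AlgHom.id F Fbar) _ = _
    rw [Algebra.TensorProduct.map_id]
    rfl
  map_comp {R R' R''} φ ψ := by
    ext t i m
    change Algebra.TensorProduct.map (ψ.hom.comp φ.hom) (AlgHom.id F Fbar) _ =
      Algebra.TensorProduct.map ψ.hom (AlgHom.id F Fbar)
        (Algebra.TensorProduct.map φ.hom (AlgHom.id F Fbar) _)
    rw [← AlgHom.comp_apply, ← Algebra.TensorProduct.map_comp, AlgHom.comp_id]

/-- The value of a character of level `i` at a point of the inverse limit. -/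
noncomputable def proGroup.eval {X : CharacterSystem F Fbar} {R : CommAlgCat.{u} F}
    (t : (proGroup X).obj R) (i : Level F Fbar) (m : X.M i) : ((R : Type u) ⊗[F] Fbar)ˣ :=
  (Subtype.val (p := fun t => t ∈ limPoints X R) t i).1 (Multiplicative.ofAdd m)

/-- The homomorphism of inverse limits dual to a compatible family of equivariant homomorphisms
between the character modules. -/
noncomputable def proGroupMap {X Y : CharacterSystem F Fbar}
    (c : ∀ i, X.M i →+[Gal(Fbar/F)] Y.M i)
    (hc : ∀ {i j} (h : i ≤ j) (m : X.M i), c j (X.infl h m) = Y.infl h (c i m)) :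
    proGroup Y ⟶ proGroup X where
  app R := CommGrpCat.ofHom
    { toFun := fun t => ⟨fun i => ⟨(t.1 i).1.comp (AddMonoidHom.toMultiplicative
          (c i : X.M i →+ Y.M i)), fun σ m => by
            have h1 := (t.1 i).2 σ (c i m)
            rw [← map_smul] at h1
            exact h1⟩,
        fun {i j} h m => by
          have h1 := t.2 h (c i m)
          rw [← hc] at h1
          exact h1⟩
      map_one' := rfl
      map_mul' := fun _ _ => rfl }
  naturality _ _ φ := by ext t; rfl

end ProTori

/-! ### The pro-tori `𝕋^iso` and `𝕋^mid` over a number field -/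

section Global

open CategoryTheory

variable (F Fbar : Type u) [Field F] [NumberField F] [Field Fbar] [Algebra F Fbar]
  [Algebra.IsAlgebraic F Fbar]

/-- The modules `M^iso_{E,S}` with their inflation maps. -/
noncomputable def isoSystem : CharacterSystem F Fbar where
  M i := Miso F i.1 (i.2 : Set (Place F))
  infl h :=
    { toFun := towerInflIso h.1 (Finset.coe_subset.mpr h.2)
      map_smul' := towerInflIso_smul h.1 _
      map_zero' := map_zero _
      map_add' := map_add _ }

variable {F Fbar}

/-- The modules `M^mid_{E,Ṡ_E}` with their inflation maps. -/
noncomputable def midSystem (V : PlaceLift F Fbar) : CharacterSystem F Fbar where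
  M i := Mmid (V.under i.1) (i.2 : Set (Place F))
  infl h :=
    { toFun := towerInflMid V h.1 (Finset.coe_subset.mpr h.2)
      map_smul' := towerInflMid_smul V h.1 _
      map_zero' := map_zero _
      map_add' := map_add _ }

variable (F Fbar) in
/-- The pro-torus `𝕋^iso`, the inverse limit of the tori with character modules `M^iso_{E,S}`. -/
noncomputable def Tiso : CommAlgCat.{u} F ⥤ CommGrpCat.{u} := proGroup (isoSystem F Fbar)

/-- The pro-torus `𝕋^mid_V̇`, the inverse limit of the tori with character modules
`M^mid_{E,Ṡ_E}`. -/
noncomputable def Tmid (V : PlaceLift F Fbar) : CommAlgCat.{u} F ⥤ CommGrpCat.{u} :=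
  proGroup (midSystem V)

/-- The homomorphism `c_iso : 𝕋^iso ⟶ 𝕋^mid_V̇` dual to the maps `c^iso`. -/
noncomputable def cIso (V : PlaceLift F Fbar) : Tiso F Fbar ⟶ Tmid V :=
  proGroupMap (X := midSystem V) (Y := isoSystem F Fbar)
    (fun i =>
      { toFun := ciso (V.under i.1) (i.2 : Set (Place F))
        map_smul' := ciso_gal_smul _ _
        map_zero' := map_zero _
        map_add' := map_add _ })
    (fun h m => ciso_towerInflMid V h.1 (Finset.coe_subset.mpr h.2) m)

end Global

end GaloisGerbe

open CategoryTheory GaloisGerbe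

/-! Write v̇ for the chosen lift of v at whatever level is in question. Equivariance forces s(f)(σ,
σv̇) = s(σ⁻¹f)(1, v̇), so a splitting of `ciso` over E is determined by the functionals f ↦ s(f)(1,
v̇). It is therefore encoded by a matrix a(w, v), with w a place of E and v a place of F. Three
conditions on the matrix suffice: every row sums to [E:F]⁻¹, the entries lie in [E:F]⁻¹ℤ, and
summing a(γw, v) over the decomposition group of v̇ gives 1 if w = v̇ and 0 otherwise
(`PlaceSplitting`). The last condition says exactly that c^iso ∘ s = id. Compatibility with
inflation from E to K becomes the identity ∑_{u∣w} [K_u:E_w] b(u, ·) = a(w, ·).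

The heart of the proof is the passage from a over E to b over K (`PlaceSplitting.exists_extension`).
The average b(u) = [K:E]⁻¹ a(u|_E) has the right row sums, integrality and inflation. Only its norm
condition fails: the decomposition sum at v̇ is spread evenly over all places x of K above v̇|_E,
instead of being concentrated at v̇. The correction moves the share of each x to v̇ in column v and
makes the opposite move in another column p(x). This changes neither the row sums nor the sums over
places above a place of E. The opposite move must not be seen by the norm condition in column p(x).
That holds when some h with h v̇ = x lies in the decomposition group of the lift of p(x), since
summation over this group then cannot distinguish v̇ from x (`norm_splittingCorrection`). Some h in
Gal(K/E) carries v̇ to x, and the density hypothesis says that every element of Gal(K/F) fixes some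
chosen lift (`exists_smul_lift_eq`); this gives p(x).

Over F itself the identity matrix is a splitting. Extending it to E₀ and then step by step along the
sequence yields the s_i. In the limit, a point of 𝕋^mid is pulled back to a character of level (X,
S) by inflating the character to some E_i containing X, applying s_i and evaluating. Compatibility
with inflation makes the result independent of i, and c^iso ∘ s_i = id gives the splitting identity
(`limitSplitting`, `cIso_limitSplitting`). -/

namespace GaloisGerbe

/-! ### Splittings at one level as matrices -/

section PlaceSplitting

set_option linter.unusedSectionVars false

open Classical in
/-- The matrix coefficients of an equivariant splitting of `c^iso` over `E`: the value of the
splitting of the function `f` at `(1, v̇)` is `∑_w f(w) coeff(w, v)`. -/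
structure PlaceSplitting {F E : Type*} [Field F] [Field E] [Algebra F E] [FiniteDimensional F E]
    (d : PlaceLift F E) where
  /-- The coefficients. -/
  coeff : Place E → Place F →₀ ℚ
  -- Constancy of the row sums sends functions of total 0 to functions of total 0; the value [E:F]⁻¹
  -- is the one that inflation preserves, starting from 1 over F.
  sum_coeff : ∀ w, ((coeff w).sum fun _ q => q) = (Module.finrank F E : ℚ)⁻¹
  integral : ∀ w v, ∃ n : ℤ, (Module.finrank F E : ℚ) * coeff w v = n
  norm : ∀ w v,
    ∑ γ : Gal(E/F) with γ • d.lift v = d.lift v, coeff (γ • w) v = if w = d.lift v then 1 else 0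

/-! ### Decomposition groups and local degrees in a tower -/

variable {F E K : Type*} [Field F] [Field E] [Field K] [Algebra F E] [Algebra E K] [Algebra F K]
  [IsScalarTower F E K] [FiniteDimensional F E] [FiniteDimensional F K] [FiniteDimensional E K]
  [IsGalois F E] [IsGalois F K] [IsGalois E K]

open Classical in
/-- A sum over a decomposition group of `K/F` of a function of the restriction to `E`. -/
theorem sum_stabilizer_restrict [CharZero K] (u : Place K) (g : Gal(E/F) → ℚ) :
    ∑ γ : Gal(K/F) with γ • u = u, g (AlgEquiv.restrictNormalHom E γ) =
      Place.localDegree E u *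
        ∑ ρ : Gal(E/F) with ρ • Place.under E u = Place.under E u, g ρ := by
  rw [← Finset.sum_fiberwise_of_maps_to (g := fun γ : Gal(K/F) => AlgEquiv.restrictNormalHom E γ)
    (t := Finset.univ.filter fun ρ : Gal(E/F) => ρ • Place.under E u = Place.under E u)
    (fun γ hγ => by
      simp only [Finset.mem_filter, Finset.mem_univ, true_and] at hγ ⊢
      rw [← Place.under_smul, hγ]), Finset.mul_sum]
  refine Finset.sum_congr rfl fun ρ hρ => ?_
  have hρ' : Place.under E u = ρ⁻¹ • Place.under E u := by
    simp only [Finset.mem_filter, Finset.mem_univ, true_and] at hρ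
    exact (inv_smul_eq_iff.mpr hρ.symm).symm
  -- The elements of the decomposition group of u that restrict to ρ are the lifts of ρ carrying u
  -- to itself, and `card_lifts` counts them.
  rw [← card_lifts ρ u u hρ', Nat.card_eq_fintype_card, Fintype.card_subtype, ← nsmul_eq_mul,
    ← Finset.sum_const, Finset.filter_filter]
  refine Finset.sum_congr (Finset.filter_congr fun γ _ => ?_) fun γ hγ => ?_
  · rw [and_comm, inv_smul_eq_iff, eq_comm (a := u)]
  · rw [(Finset.mem_filter.mp hγ).2.1]

/-- Transitivity of local degrees. -/
theorem Place.localDegree_mul [CharZero K] [CharZero E] (u : Place K) :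
    (Place.localDegree F u : ℚ) = Place.localDegree E u * Place.localDegree F (Place.under E u) := by
  classical
  have h := sum_stabilizer_restrict (F := F) (E := E) u (fun _ => 1)
  simp only [Finset.sum_const, nsmul_eq_mul, mul_one] at h
  rw [Place.localDegree_eq_card, Place.localDegree_eq_card (E := F) (Place.under E u),
    Nat.card_eq_fintype_card, Nat.card_eq_fintype_card]
  simpa only [← Fintype.card_subtype, MulAction.mem_stabilizer_iff] using h

/-- The places of `K` above a place of `E`. -/
noncomputable def Place.fibre (K : Type*) [Field K] [Algebra E K] [FiniteDimensional E K]
    [IsGalois E K] (w : Place E) : Finset (Place K) :=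
  (Place.fibre_finite (K := K) w).toFinset

@[simp] theorem Place.mem_fibre {w : Place E} {u : Place K} :
    u ∈ Place.fibre K w ↔ Place.under E u = w := by
  simp [Place.fibre]

theorem Place.localDegree_mul_card_fibre [CharZero K] (u : Place K) :
    (Place.localDegree E u : ℚ) * (Place.fibre K (Place.under E u)).card =
      Module.finrank E K := by
  rw [← Place.localDegree_mul_ncard u,
    Set.ncard_eq_toFinset_card _ (Place.fibre_finite (K := K) (Place.under E u)), Nat.cast_mul]
  rfl

/-- Such places are conjugate under Gal(K/E), and conjugation preserves local degrees. -/
theorem Place.localDegree_eq_of_under_eq [CharZero K] {u u' : Place K}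
    (h : Place.under E u = Place.under E u') :
    Place.localDegree E u = Place.localDegree E u' := by
  obtain ⟨τ, rfl⟩ := Place.exists_smul_eq h
  exact (Place.localDegree_smul (F := E) τ u).symm

/-! ### The correction term -/

open Classical in
/-- The correction term for the extension of a splitting from `E` to `K`. Here `p x` is a place of
`F` such that an element of `Gal(K/E)` mapping the chosen place below `x` to `x` fixes the chosen
lift of `p x`. -/
noncomputable def splittingCorrection (E : Type*) {F K : Type*} [Field F] [Field E] [Field K]
    [Algebra E K] [Algebra F K] [FiniteDimensional F K] [FiniteDimensional E K] [IsGalois E K]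
    (d : PlaceLift F K) (p : Place K → Place F) (u : Place K) : Place F →₀ ℚ :=
  ∑ x ∈ Place.fibre K (Place.under E (d.lift (Place.under F u))),
    ((if u = d.lift (Place.under F u) then 1 else 0) - (if u = x then 1 else 0) : ℚ) •
      (Finsupp.single (Place.under F u) 1 - Finsupp.single (p x) 1)

/-- Each summand is a multiple of a difference of two unit masses, so the correction leaves the row
sums alone. -/
theorem sum_splittingCorrection (d : PlaceLift F K) (p : Place K → Place F) (u : Place K) :
    ((splittingCorrection E d p u).sum fun _ q => q) = 0 := by
  have h : ∀ g : Place F →₀ ℚ, (g.sum fun _ q => q) =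
      Finsupp.linearCombination ℚ (fun _ : Place F => (1 : ℚ)) g := fun g => by
    simp [Finsupp.linearCombination_apply]
  rw [h, splittingCorrection, map_sum]
  refine Finset.sum_eq_zero fun x _ => ?_
  simp

theorem splittingCorrection_integral (d : PlaceLift F K) (p : Place K → Place F) (u : Place K)
    (v : Place F) : ∃ n : ℤ, splittingCorrection E d p u v = n := by
  classical
  refine ⟨∑ x ∈ Place.fibre K (Place.under E (d.lift (Place.under F u))),
    ((if u = d.lift (Place.under F u) then 1 else 0) - (if u = x then 1 else 0) : ℤ) *
      ((if Place.under F u = v then 1 else 0) - (if p x = v then 1 else 0)), ?_⟩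
  rw [splittingCorrection, Finsupp.finsetSum_apply]
  push_cast
  refine Finset.sum_congr rfl fun x _ => ?_
  simp [Finsupp.single_apply]

/-- For fixed x the scalar moves one unit from x to v̇ within a single fibre, so it cancels in the
sum over u. Hence the correction does not disturb compatibility with inflation. -/
theorem sum_fibre_splittingCorrection (d : PlaceLift F K) (p : Place K → Place F) (w : Place E) :
    ∑ u ∈ Place.fibre K w, splittingCorrection E d p u = 0 := by
  classical
  have hv : ∀ u ∈ Place.fibre K w, Place.under F u = Place.under F w := fun u hu => by
    rw [← Place.mem_fibre.mp hu, Place.under_under]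
  simp only [splittingCorrection]
  -- All u above w lie above the same place of F, so the range of x no longer depends on u.
  rw [Finset.sum_congr rfl fun u hu => by rw [hv u hu]]
  by_cases hw : Place.under E (d.lift (Place.under F w)) = w
  · rw [hw, Finset.sum_comm]
    refine Finset.sum_eq_zero fun x hx => ?_
    rw [← Finset.sum_smul, Finset.sum_sub_distrib, Finset.sum_ite_eq', Finset.sum_ite_eq',
      if_pos hx, if_pos (Place.mem_fibre.mpr hw), sub_self, zero_smul]
  -- If w is not a chosen place, then neither v̇ nor any x lies above w, and every scalar vanishes.
  · refine Finset.sum_eq_zero fun u hu => Finset.sum_eq_zero fun x hx => ?_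
    rw [Place.mem_fibre] at hu hx
    rw [if_neg, if_neg, sub_zero, zero_smul]
    · rintro rfl
      exact hw (hx.symm.trans hu)
    · rintro rfl
      exact hw hu

-- The masses in the columns p(x) drop out: the element h supplied by `hp` lies in the group over
-- which one sums, and it exchanges the conditions γu = v̇ and γu = x. What survives is the mass in
-- the column of the place under u, where each γ contributes the same amount.
open Classical in
theorem norm_splittingCorrection (d : PlaceLift F K) (p : Place K → Place F)
    (hp : ∀ x : Place K, Place.under E x = Place.under E (d.lift (Place.under F x)) →
      ∃ h : Gal(K/F), h • d.lift (Place.under F x) = x ∧ h • d.lift (p x) = d.lift (p x))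
    (u : Place K) (v : Place F) :
    ∑ γ : Gal(K/F) with γ • d.lift v = d.lift v, splittingCorrection E d p (γ • u) v =
      if Place.under F u = v then
        ((Finset.univ.filter fun γ : Gal(K/F) => γ • d.lift v = d.lift v).card : ℚ) *
          ((if u = d.lift v then ((Place.fibre K (Place.under E (d.lift v))).card : ℚ) else 0) -
            (if Place.under E u = Place.under E (d.lift v) then 1 else 0))
      else 0 := by
  have hz : ∀ x ∈ Place.fibre K (Place.under E (d.lift (Place.under F u))), p x = v →
      ∑ γ : Gal(K/F) with γ • d.lift v = d.lift v,
        ((if γ • u = d.lift (Place.under F u) then 1 else 0) -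
          (if γ • u = x then 1 else 0) : ℚ) = 0 := by
    intro x hx hpx
    have hxF : Place.under F x = Place.under F u := by
      rw [← Place.under_under F E x, Place.mem_fibre.mp hx, Place.under_under, d.under_lift]
    obtain ⟨h, h1, h2⟩ := hp x (by rw [hxF]; exact Place.mem_fibre.mp hx)
    rw [hxF] at h1
    rw [hpx] at h2
    rw [Finset.sum_sub_distrib, sub_eq_zero]
    -- Here h fixes the lift of v = p(x), so γ ↦ hγ permutes its decomposition group, and γu = v̇
    -- holds exactly when hγu = h v̇ = x.
    refine Finset.sum_equiv (Equiv.mulLeft h) (fun γ => ?_) (fun γ _ => ?_)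
    · simp only [Finset.mem_filter, Finset.mem_univ, true_and, Equiv.coe_mulLeft, mul_smul]
      rw [← eq_inv_smul_iff (g := h), inv_smul_eq_iff.mpr h2.symm]
    · rw [Equiv.coe_mulLeft, mul_smul, ← h1, smul_left_cancel_iff]
  simp only [splittingCorrection, Finsupp.finsetSum_apply, Place.under_smul_self]
  rw [Finset.sum_comm]
  simp only [Finsupp.smul_apply, smul_eq_mul, Finsupp.sub_apply, ← Finset.sum_mul]
  -- The term of p(x) may be dropped in column v: when p(x) = v, the sum over γ in front of it is
  -- already zero. This includes the case where p(x) is the place under u.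
  have h1 : ∀ x ∈ Place.fibre K (Place.under E (d.lift (Place.under F u))),
      (∑ γ : Gal(K/F) with γ • d.lift v = d.lift v,
        ((if γ • u = d.lift (Place.under F u) then 1 else 0) -
          (if γ • u = x then 1 else 0) : ℚ)) *
        (Finsupp.single (Place.under F u) (1 : ℚ) v - Finsupp.single (p x) (1 : ℚ) v) =
      (∑ γ : Gal(K/F) with γ • d.lift v = d.lift v,
        ((if γ • u = d.lift (Place.under F u) then 1 else 0) -
          (if γ • u = x then 1 else 0) : ℚ)) * (if Place.under F u = v then 1 else 0) := by
    intro x hx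
    by_cases hpx : p x = v
    · rw [hz x hx hpx, zero_mul, zero_mul]
    · rw [Finsupp.single_apply, Finsupp.single_apply, if_neg hpx, sub_zero]
  rw [Finset.sum_congr rfl h1, ← Finset.sum_mul, Finset.sum_comm]
  by_cases huv : Place.under F u = v
  · rw [if_pos huv, if_pos huv, mul_one, huv, ← nsmul_eq_mul, ← Finset.sum_const]
    refine Finset.sum_congr rfl fun γ hγ => ?_
    have hγ' : γ • d.lift v = d.lift v := (Finset.mem_filter.mp hγ).2
    -- Since γ fixes v̇, it preserves both the fibre over v̇|_E and the property of being v̇, so the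
    -- γ-th term does not depend on γ.
    have hE : Place.under E (γ • u) = Place.under E (d.lift v) ↔
        Place.under E u = Place.under E (d.lift v) := by
      conv_lhs => rw [← hγ', Place.under_smul, Place.under_smul, smul_left_cancel_iff]
    have hK : γ • u = d.lift v ↔ u = d.lift v := by
      conv_lhs => rw [← hγ', smul_left_cancel_iff]
    rw [Finset.sum_sub_distrib, Finset.sum_const, Finset.sum_ite_eq, nsmul_eq_mul]
    simp only [Place.mem_fibre, hE, hK, mul_ite, mul_one, mul_zero]
  · rw [if_neg huv, if_neg huv, mul_zero]

/-! ### Extending a splitting from E to K -/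

/-- Extension of a splitting from `E` to `K`. -/
theorem PlaceSplitting.exists_extension [NumberField E] [CharZero K] (d : PlaceLift F K)
    (hd : ∀ σ : Gal(K/F), ∃ v, σ • d.lift v = d.lift v) (a : PlaceSplitting (d.under E)) :
    ∃ b : PlaceSplitting d, ∀ w : Place E,
      ∑ u ∈ Place.fibre K w, (Place.localDegree E u : ℚ) • b.coeff u = a.coeff w := by
  classical
  -- The fixed-lift hypothesis is applied to an element of Gal(K/E) carrying v̇ to x. Outside the
  -- fibres over chosen places the value of p is irrelevant, and the place under x serves as a
  -- default.
  have hex : ∀ x : Place K, ∃ v : Place F,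
      Place.under E x = Place.under E (d.lift (Place.under F x)) →
      ∃ h : Gal(K/F), h • d.lift (Place.under F x) = x ∧ h • d.lift v = d.lift v := by
    intro x
    by_cases hx : Place.under E x = Place.under E (d.lift (Place.under F x))
    · obtain ⟨τ, hτ⟩ := Place.exists_smul_eq hx.symm
      obtain ⟨v, hv⟩ := hd (AlgEquiv.restrictScalars F τ)
      exact ⟨v, fun _ => ⟨_, by rw [Place.restrictScalars_smul, hτ], hv⟩⟩
    · exact ⟨Place.under F x, fun h => absurd h hx⟩
  choose p hp using hex
  have hfin : (Module.finrank E K : ℚ) ≠ 0 := Nat.cast_ne_zero.mpr Module.finrank_pos.ne'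
  have hfin' : (Module.finrank F K : ℚ) = Module.finrank F E * Module.finrank E K := by
    rw [← Module.finrank_mul_finrank F E K, Nat.cast_mul]
  have hloc : ∀ w : Place E, (Place.localDegree F w : ℚ) ≠ 0 := fun w =>
    Nat.cast_ne_zero.mpr (Place.localDegree_ne_zero w)
  -- The local degree of E/F at the chosen place over v. Dividing by it turns the order [K_v̇:F_v]
  -- of the decomposition group, which appears in the norm of the correction, into [K_v̇:E_v̇].
  let e : Place K → ℚ := fun u =>
    Place.localDegree F (Place.under E (d.lift (Place.under F u)))
  have he : ∀ u, e u ≠ 0 := fun u => hloc _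
  refine ⟨⟨fun u => (Module.finrank E K : ℚ)⁻¹ • a.coeff (Place.under E u) +
    (e u * Module.finrank E K)⁻¹ • splittingCorrection E d p u, fun u => ?_, fun u v => ?_,
    fun u v => ?_⟩, fun w => ?_⟩
  · rw [Finsupp.sum_add_index' (fun _ => rfl) (fun _ _ _ => rfl),
      Finsupp.sum_smul_index' (fun _ => rfl), Finsupp.sum_smul_index' (fun _ => rfl)]
    simp only [smul_eq_mul, ← Finsupp.mul_sum]
    rw [sum_splittingCorrection, a.sum_coeff, mul_zero, add_zero, hfin', mul_inv, mul_comm]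
  · obtain ⟨m, hm⟩ := a.integral (Place.under E u) v
    obtain ⟨n, hn⟩ := splittingCorrection_integral (E := E) d p u v
    have h1 := Place.localDegree_mul_card_fibre (E := F)
      (Place.under E (d.lift (Place.under F u)))
    -- After multiplication by [K:F] the correction has coefficient [E:F]/e(u), which is the number
    -- of places of E above v and hence an integer.
    refine ⟨m + (Place.fibre E (Place.under F (Place.under E (d.lift (Place.under F u))))).card * n,
      ?_⟩
    rw [Finsupp.add_apply, Finsupp.smul_apply, Finsupp.smul_apply, hn, hfin', smul_eq_mul,
      smul_eq_mul, mul_add]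
    push_cast
    rw [← hm]
    congr 1
    · field_simp
    · rw [← h1]
      have := he u
      change e u * _ * _ * _ = _
      field_simp
  -- With n places of K above v̇|_E, the average contributes 1/n at each of them. The correction
  -- contributes ([K_v̇:E_v̇]/[K:E]) · (n − 1) at v̇ and −[K_v̇:E_v̇]/[K:E] at the others. As
  -- [K_v̇:E_v̇] · n = [K:E], the total is 1 at v̇ and 0 elsewhere.
  · have h1 := sum_stabilizer_restrict (F := F) (E := E) (d.lift v)
      (fun ρ => a.coeff (ρ • Place.under E u) v)
    have h2 := a.norm (Place.under E u) v
    have h3 := norm_splittingCorrection d p hp u v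
    have h4 := sum_stabilizer_restrict (F := F) (E := E) (d.lift v) (fun _ => 1)
    have h5 := Place.localDegree_mul_card_fibre (E := E) (d.lift v)
    have h6 : ((Finset.univ.filter fun ρ : Gal(E/F) =>
        ρ • Place.under E (d.lift v) = Place.under E (d.lift v)).card : ℚ) =
        Place.localDegree F (Place.under E (d.lift v)) := by
      rw [Place.localDegree_eq_card, Nat.card_eq_fintype_card]
      simp only [← Fintype.card_subtype, MulAction.mem_stabilizer_iff]
    have hl : (Place.localDegree E (d.lift v) : ℚ) ≠ 0 :=
      Nat.cast_ne_zero.mpr (Place.localDegree_ne_zero _)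
    change ∑ ρ : Gal(E/F) with ρ • Place.under E (d.lift v) = Place.under E (d.lift v),
      a.coeff (ρ • Place.under E u) v = if Place.under E u = Place.under E (d.lift v)
        then 1 else 0 at h2
    simp only [Finset.sum_const, nsmul_eq_mul, mul_one, h6] at h4
    simp only [← Place.under_smul] at h1
    rw [h4] at h3
    have h7 : ∀ γ : Gal(K/F), e (γ • u) = e u := fun γ => by
      simp only [e, Place.under_smul_self]
    simp only [Finsupp.add_apply, Finsupp.smul_apply, smul_eq_mul, h7, Finset.sum_add_distrib,
      ← Finset.mul_sum]
    rw [h1, h2, h3]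
    by_cases huv : Place.under F u = v
    · have h8 : e u = Place.localDegree F (Place.under E (d.lift v)) := by simp only [e, huv]
      have h9 := hloc (Place.under E (d.lift v))
      rw [if_pos huv, h8]
      by_cases hu : u = d.lift v
      · simp only [hu, if_true, ← h5]
        have h10 : ((Place.fibre K (Place.under E (d.lift v))).card : ℚ) ≠ 0 := by
          intro h
          rw [h, mul_zero] at h5
          exact hfin h5.symm
        field_simp
        ring
      · simp only [hu, if_false]
        field_simp
        ring
    · have h8 : u ≠ d.lift v := by
        rintro rfl
        exact huv (d.under_lift v)
      have h9 : Place.under E u ≠ Place.under E (d.lift v) := by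
        intro h
        apply huv
        rw [← Place.under_under F E u, h, Place.under_under, d.under_lift]
      simp [huv, h8, h9]
  -- The local degree and e are constant on the fibre, so they factor out: the corrections sum to
  -- zero and the n equal averages contribute [K_u:E_w] · n/[K:E] = 1 times the row of w.
  · obtain ⟨u₀, rfl⟩ := Place.under_surjective E (K := K) w
    have h1 : ∀ u ∈ Place.fibre K (Place.under E u₀), (Place.localDegree E u : ℚ) •
        ((Module.finrank E K : ℚ)⁻¹ • a.coeff (Place.under E u) +
        (e u * Module.finrank E K)⁻¹ • splittingCorrection E d p u) =
        ((Place.localDegree E u₀ : ℚ) * (Module.finrank E K : ℚ)⁻¹) •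
          a.coeff (Place.under E u₀) +
        ((Place.localDegree E u₀ : ℚ) * (e u₀ * Module.finrank E K)⁻¹) •
          splittingCorrection E d p u := by
      intro u hu
      have hu' := Place.mem_fibre.mp hu
      have h2 : e u = e u₀ := by
        simp only [e, ← Place.under_under F E u, hu', Place.under_under]
      rw [Place.localDegree_eq_of_under_eq hu', hu', h2, smul_add, smul_smul, smul_smul]
    rw [Finset.sum_congr rfl h1, Finset.sum_add_distrib, ← Finset.smul_sum, ← Finset.smul_sum,
      sum_fibre_splittingCorrection, smul_zero, add_zero, Finset.sum_const,
      ← Nat.cast_smul_eq_nsmul ℚ, smul_smul,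
      mul_right_comm, Place.localDegree_mul_card_fibre, mul_inv_cancel₀ hfin, one_smul]

end PlaceSplitting

/-! ### From matrices to equivariant homomorphisms -/

section SplittingHom

set_option linter.unusedSectionVars false

theorem Place.under_self {F : Type*} [Field F] (w : Place F) : Place.under F w = w := by
  induction w using Place.ind with
  | h v hv => rfl

open Classical in
/-- The splitting over the base field. -/
noncomputable def PlaceSplitting.base {F : Type*} [Field F] (d : PlaceLift F F) :
    PlaceSplitting d where
  coeff w := Finsupp.single w 1
  sum_coeff w := by simp
  integral w v := ⟨if w = v then 1 else 0, by simp [Finsupp.single_apply]⟩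
  norm w v := by
    -- Over F every lift is the place itself and the Galois group is trivial, so the norm condition
    -- has a single term.
    have h1 : d.lift v = v := by rw [← Place.under_self (d.lift v), d.under_lift]
    have h2 : ∀ (γ : Gal(F/F)) (w : Place F), γ • w = w := fun γ w => by
      rw [← Place.under_self (γ • w), Place.under_smul_self, Place.under_self]
    have h3 : Fintype.card Gal(F/F) = 1 := by
      rw [← Nat.card_eq_fintype_card, IsGalois.card_aut_eq_finrank, Module.finrank_self]
    simp [h1, h2, h3, Finsupp.single_apply]

variable {F E K : Type*} [Field F] [Field E] [Field K] [Algebra F E] [Algebra E K] [Algebra F K]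
  [IsScalarTower F E K] [FiniteDimensional F E] [FiniteDimensional F K] [FiniteDimensional E K]
  [IsGalois F E] [IsGalois F K] [IsGalois E K]

theorem translate_add (τ : Gal(E/F)) (f g : Place E →₀ ℚ) :
    translate τ (f + g) = translate τ f + translate τ g := by
  ext w
  simp

theorem translate_single (τ : Gal(E/F)) (w : Place E) (q : ℚ) :
    translate τ (Finsupp.single w q) = Finsupp.single (τ • w) q :=
  Finsupp.equivMapDomain_single _ _ _

theorem translate_translate (σ τ : Gal(E/F)) (f : Place E →₀ ℚ) :
    translate σ (translate τ f) = translate (σ * τ) f := by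
  ext w
  simp [mul_smul]

theorem inflIsoFun_add (f g : Place E →₀ ℚ) :
    inflIsoFun K (f + g) = inflIsoFun K f + inflIsoFun K g := by
  ext u
  simp [inflIsoFun_apply, mul_add]

theorem inflIsoFun_single (w : Place E) (q : ℚ) :
    inflIsoFun K (Finsupp.single w q) =
      ∑ u ∈ Place.fibre K w, Finsupp.single u (Place.localDegree E u * q) := by
  classical
  ext u
  simp only [inflIsoFun_apply, Finsupp.finsetSum_apply, Finsupp.single_apply,
    Finset.sum_ite_eq', Place.mem_fibre, mul_ite, mul_zero]
  simp only [eq_comm]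

theorem translate_inflIsoFun [CharZero K] (σ : Gal(K/F)) (f : Place E →₀ ℚ) :
    translate σ (inflIsoFun K f) =
      inflIsoFun K (translate (AlgEquiv.restrictNormalHom E σ) f) := by
  ext u
  rw [translate_apply, inflIsoFun_apply, inflIsoFun_apply, translate_apply, Place.localDegree_smul,
    Place.under_smul, map_inv]

namespace PlaceSplitting

variable {d : PlaceLift F E} (a : PlaceSplitting d)

/-- The linear map with matrix `a.coeff`. -/
noncomputable def map : (Place E →₀ ℚ) →ₗ[ℚ] (Place F →₀ ℚ) :=
  Finsupp.linearCombination ℚ a.coeff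

theorem map_single (w : Place E) (q : ℚ) : a.map (Finsupp.single w q) = q • a.coeff w :=
  Finsupp.linearCombination_single _ _ _

/-- Constant row sums make the total of the image a fixed multiple of the total of f; thus functions
of total 0 go to functions of total 0, as membership in M^mid demands for each σ. -/
theorem sum_map (f : Place E →₀ ℚ) :
    ((a.map f).sum fun _ q => q) = (Module.finrank F E : ℚ)⁻¹ * f.sum fun _ q => q := by
  induction f using Finsupp.induction_linear with
  | zero => simp
  | add f g hf hg =>
    rw [map_add, Finsupp.sum_add_index' (fun _ => rfl) (fun _ _ _ => rfl), hf, hg,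
      Finsupp.sum_add_index' (fun _ => rfl) (fun _ _ _ => rfl), mul_add]
  | single w q =>
    rw [map_single, Finsupp.sum_smul_index' (fun _ => rfl)]
    simp only [smul_eq_mul, ← Finsupp.mul_sum]
    rw [a.sum_coeff, Finsupp.sum_single_index rfl, mul_comm]

theorem map_integral {f : Place E →₀ ℚ} (hf : ∀ w, ∃ n : ℤ, f w = n) (v : Place F) :
    ∃ n : ℤ, (Module.finrank F E : ℚ) * a.map f v = n := by
  choose m hm using hf
  choose n hn using fun w => a.integral w v
  refine ⟨∑ w ∈ f.support, m w * n w, ?_⟩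
  rw [map, Finsupp.linearCombination_apply, Finsupp.sum, Finsupp.finsetSum_apply, Finset.mul_sum]
  push_cast
  refine Finset.sum_congr rfl fun w _ => ?_
  rw [← hm, ← hn, Pi.smul_apply, smul_eq_mul, mul_left_comm]

-- Both sides are linear in f, and on a point mass the identity is the norm condition on the
-- coefficients.
open Classical in
theorem norm_map (f : Place E →₀ ℚ) (v : Place F) :
    ∑ γ : Gal(E/F) with γ • d.lift v = d.lift v, a.map (translate γ f) v = f (d.lift v) := by
  induction f using Finsupp.induction_linear with
  | zero =>
    refine Finset.sum_eq_zero fun γ _ => ?_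
    rw [show translate γ (0 : Place E →₀ ℚ) = 0 from rfl, map_zero, Finsupp.zero_apply]
  | add f g hf hg =>
    simp only [translate_add, map_add, Finsupp.add_apply, Finset.sum_add_distrib, hf, hg]
  | single w q =>
    simp only [translate_single, map_single, Finsupp.smul_apply, smul_eq_mul, ← Finset.mul_sum,
      a.norm, Finsupp.single_apply, mul_ite, mul_one, mul_zero]

/-- The function on `Gal(E/F) × V_E` defined by a splitting. -/
noncomputable def toFun (f : Place E →₀ ℚ) : Gal(E/F) → Place E →₀ ℚ := fun σ =>
  translate σ (Finsupp.mapDomain d.lift (a.map (translate σ⁻¹ f)))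

theorem lift_injective (d : PlaceLift F E) : Function.Injective d.lift := fun v v' h => by
  rw [← d.under_lift v, h, d.under_lift]

theorem toFun_of_eq (f : Place E →₀ ℚ) {σ : Gal(E/F)} {w : Place E} {v : Place F}
    (h : σ⁻¹ • w = d.lift v) : a.toFun f σ w = a.map (translate σ⁻¹ f) v := by
  rw [toFun, translate_apply, h, Finsupp.mapDomain_apply (lift_injective d)]

theorem toFun_of_notMem (f : Place E →₀ ℚ) {σ : Gal(E/F)} {w : Place E}
    (h : σ⁻¹ • w ∉ Set.range d.lift) : a.toFun f σ w = 0 := by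
  rw [toFun, translate_apply, Finsupp.mapDomain_of_notMem_range _ _ h]

/-- Write w = σ₀v̇. Only those σ with σ⁻¹w = v̇ contribute, that is, those for which γ = σ⁻¹σ₀ lies
in the decomposition group of v̇. The sum over γ is then `norm_map` for σ₀⁻¹f, with value
(σ₀⁻¹f)(v̇) = f(w). -/
theorem sum_toFun (f : Place E →₀ ℚ) (w : Place E) : ∑ σ, a.toFun f σ w = f w := by
  classical
  obtain ⟨σ₀, h₀⟩ := Place.exists_smul_eq (E := F) (u := d.lift (Place.under F w)) (u' := w)
    (d.under_lift _)
  have h1 := a.norm_map (translate σ₀⁻¹ f) (Place.under F w)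
  rw [translate_apply, inv_inv, h₀, Finset.sum_filter] at h1
  rw [← h1]
  refine Fintype.sum_equiv ((Equiv.inv _).trans (Equiv.mulRight σ₀)) _ _ fun σ => ?_
  change _ = if (σ⁻¹ * σ₀) • d.lift (Place.under F w) = d.lift (Place.under F w) then
    a.map (translate (σ⁻¹ * σ₀) (translate σ₀⁻¹ f)) (Place.under F w) else 0
  rw [mul_smul, h₀, translate_translate, mul_inv_cancel_right]
  split_ifs with h
  · exact a.toFun_of_eq f h
  · refine a.toFun_of_notMem f ?_
    rintro ⟨v, hv⟩
    have h2 : v = Place.under F w := by rw [← d.under_lift v, hv, Place.under_smul_self]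
    rw [← hv, h2] at h
    exact h rfl

/-- The equivariant splitting of `c^iso`. -/
noncomputable def hom : Miso F E Set.univ →+[Gal(E/F)] Mmid d Set.univ where
  toFun f := ⟨a.toFun f.1, fun σ w => by
      by_cases h : σ⁻¹ • w ∈ Set.range d.lift
      · obtain ⟨v, hv⟩ := h
        rw [a.toFun_of_eq f.1 hv.symm]
        exact a.map_integral (f := translate σ⁻¹ f.1) (fun w => f.2.1 _) v
      · exact ⟨0, by rw [a.toFun_of_notMem f.1 h]; simp⟩,
    fun σ => by
      rw [PlaceSplitting.toFun, sum_translate, Finsupp.sum_mapDomain_index (fun _ => rfl)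
        (fun _ _ _ => rfl), a.sum_map, sum_translate, f.2.2.2, mul_zero],
    fun w => by
      rw [a.sum_toFun]
      exact f.2.1 w,
    fun σ w h => a.toFun_of_notMem f.1 (by rwa [Set.image_univ] at h)⟩
  map_smul' τ f := by
    apply Subtype.ext; funext σ
    change translate σ (Finsupp.mapDomain d.lift (a.map (translate σ⁻¹ (translate τ f.1)))) =
      translate τ (translate (τ⁻¹ * σ)
        (Finsupp.mapDomain d.lift (a.map (translate (τ⁻¹ * σ)⁻¹ f.1))))
    -- On both sides the outer translation is by σ and the matrix is applied to σ⁻¹τf.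
    rw [translate_translate, translate_translate, mul_inv_cancel_left, mul_inv_rev, inv_inv]
  map_zero' := by
    apply Subtype.ext; funext σ
    change translate σ (Finsupp.mapDomain d.lift (a.map 0)) = 0
    rw [map_zero, Finsupp.mapDomain_zero]
    rfl
  map_add' f g := by
    apply Subtype.ext; funext σ
    change translate σ (Finsupp.mapDomain d.lift (a.map (translate σ⁻¹ (f.1 + g.1)))) = _
    rw [translate_add, map_add, Finsupp.mapDomain_add, translate_add]
    rfl

theorem hom_val (f : Miso F E Set.univ) : (a.hom f).1 = a.toFun f.1 := rfl

theorem ciso_hom (f : Miso F E Set.univ) : ciso d Set.univ (a.hom f) = f := by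
  apply Subtype.ext; ext w
  rw [ciso_apply]
  exact a.sum_toFun f.1 w

end PlaceSplitting

/-! ### Compatibility of the homomorphisms with inflation -/

/-- Inflating a point mass at w puts weight [K_u:E_w] on each u above w, so by linearity the
hypothesis on the coefficients is the whole claim. -/
theorem PlaceSplitting.map_inflIsoFun [CharZero K] {d : PlaceLift F K} {e : PlaceLift F E}
    {a : PlaceSplitting e} {b : PlaceSplitting d}
    (h : ∀ w : Place E, ∑ u ∈ Place.fibre K w, (Place.localDegree E u : ℚ) • b.coeff u = a.coeff w)
    (f : Place E →₀ ℚ) : b.map (inflIsoFun K f) = a.map f := by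
  induction f using Finsupp.induction_linear with
  | zero =>
    have : inflIsoFun K (0 : Place E →₀ ℚ) = 0 := by ext u; simp [inflIsoFun_apply]
    rw [this, map_zero, map_zero]
  | add f g hf hg => rw [inflIsoFun_add, map_add, hf, hg, map_add]
  | single w q =>
    rw [inflIsoFun_single, map_sum, map_single, ← h, Finset.smul_sum]
    refine Finset.sum_congr rfl fun u _ => ?_
    rw [map_single, smul_smul, mul_comm]

/-- Compatibility of the splittings with inflation. -/
theorem PlaceSplitting.hom_inflIso [NumberField E] [CharZero K] {d : PlaceLift F K}
    {e : PlaceLift F E} (he : d.under E = e) {a : PlaceSplitting e} {b : PlaceSplitting d}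
    (h : ∀ w : Place E, ∑ u ∈ Place.fibre K w, (Place.localDegree E u : ℚ) • b.coeff u = a.coeff w)
    (f : Miso F E Set.univ) :
    b.hom (inflIso subset_rfl f) = inflMid d he subset_rfl (a.hom f) := by
  subst he
  apply Subtype.ext; funext σ; ext u
  rw [inflMid_val, inflMidFun_apply, hom_val, hom_val, Set.image_univ]
  split_ifs with hu
  · obtain ⟨v, hv⟩ := hu
    -- If σ⁻¹u is the lift of v to K, its restriction to E is the lift of v to E, so both sides are
    -- evaluated in the same column v. Otherwise both sides vanish.
    have hv' : (AlgEquiv.restrictNormalHom E σ)⁻¹ • Place.under E u = (d.under E).lift v := by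
      rw [← map_inv, ← Place.under_smul, ← hv]
      rfl
    rw [b.toFun_of_eq _ hv.symm, a.toFun_of_eq _ hv', ← map_inv]
    change b.map (translate σ⁻¹ (inflIsoFun K f.1)) v = _
    rw [translate_inflIsoFun, map_inflIsoFun h]
  · exact b.toFun_of_notMem _ hu

end SplittingHom

/-! ### Inflation between subextensions of F̄ -/

section TowerSplitting

set_option linter.unusedSectionVars false

/-- This is transitivity of local degrees. -/
theorem inflIso_inflIso {F E K L : Type*} [Field F] [Field E] [Field K] [Field L] [Algebra F E]
    [Algebra F K] [Algebra F L] [Algebra E K] [Algebra E L] [Algebra K L] [IsScalarTower F E K]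
    [IsScalarTower F E L] [IsScalarTower F K L] [IsScalarTower E K L] [FiniteDimensional F E]
    [FiniteDimensional F K] [FiniteDimensional F L] [FiniteDimensional E K]
    [FiniteDimensional E L] [FiniteDimensional K L] [IsGalois F E] [IsGalois F K] [IsGalois F L]
    [IsGalois E K] [IsGalois E L] [IsGalois K L] [NumberField E] [NumberField K] [CharZero L]
    {S S' S'' : Set (Place F)} (h : S ⊆ S') (h' : S' ⊆ S'') (f : Miso F E S) :
    (inflIso h' (inflIso h f : Miso F K S') : Miso F L S'') = inflIso (h.trans h') f := by
  apply Subtype.ext; ext u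
  rw [inflIso_apply, inflIso_apply, inflIso_apply, Place.under_under, ← mul_assoc,
    Place.localDegree_mul (F := E) (E := K) u]

theorem Place.localDegree_eq_one_of_surjective {E K : Type*} [Field E] [Field K] [Algebra E K]
    [CharZero K] [FiniteDimensional E K] [IsGalois E K]
    (h : Function.Surjective (algebraMap E K)) (u : Place K) : Place.localDegree E u = 1 := by
  have hs : Subsingleton Gal(K/E) := ⟨fun σ τ => by
    ext x
    obtain ⟨y, rfl⟩ := h x
    rw [σ.commutes, τ.commutes]⟩
  rw [Place.localDegree_eq_card]
  exact Nat.card_of_subsingleton (1 : MulAction.stabilizer Gal(K/E) u)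

variable {F Fbar : Type*} [Field F] [NumberField F] [Field Fbar] [Algebra F Fbar]
  [Algebra.IsAlgebraic F Fbar]

theorem towerInflIso_towerInflIso {E K L : FiniteGaloisIntermediateField F Fbar} (h : E ≤ K)
    (h' : K ≤ L) {S S' S'' : Set (Place F)} (hS : S ⊆ S') (hS' : S' ⊆ S'') (f : Miso F E S) :
    towerInflIso h' hS' (towerInflIso h hS f) = towerInflIso (h.trans h') (hS.trans hS') f := by
  let _ : Algebra E K := (IntermediateField.inclusion h).toRingHom.toAlgebra
  let _ : Algebra K L := (IntermediateField.inclusion h').toRingHom.toAlgebra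
  let _ : Algebra E L := (IntermediateField.inclusion (h.trans h')).toRingHom.toAlgebra
  have : IsScalarTower F E K := IsScalarTower.of_algebraMap_eq' rfl
  have : IsScalarTower F E L := IsScalarTower.of_algebraMap_eq' rfl
  have : IsScalarTower F K L := IsScalarTower.of_algebraMap_eq' rfl
  have : IsScalarTower E K L := IsScalarTower.of_algebraMap_eq' rfl
  have : FiniteDimensional E K := FiniteDimensional.right F E K
  have : FiniteDimensional E L := FiniteDimensional.right F E L
  have : FiniteDimensional K L := FiniteDimensional.right F K L
  have : IsGalois E K := IsGalois.tower_top_of_isGalois F E K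
  have : IsGalois E L := IsGalois.tower_top_of_isGalois F E L
  have : IsGalois K L := IsGalois.tower_top_of_isGalois F K L
  have : NumberField E := NumberField.of_module_finite F E
  have : NumberField K := NumberField.of_module_finite F K
  have : CharZero L := charZero_of_injective_algebraMap (algebraMap F L).injective
  exact inflIso_inflIso hS hS' f

theorem inclusion_isIntegral {E K : FiniteGaloisIntermediateField F Fbar} (h : E ≤ K) :
    (IntermediateField.inclusion h).toRingHom.IsIntegral := by
  let _ : Algebra E K := (IntermediateField.inclusion h).toRingHom.toAlgebra
  have : IsScalarTower F E K := IsScalarTower.of_algebraMap_eq' rfl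
  have : FiniteDimensional E K := FiniteDimensional.right F E K
  exact algebraMap_isIntegral_iff.mpr inferInstance

/-- The two inclusions make K/E trivial, so the local degree is 1 and inflation reduces to transport
of places along the inclusion. -/
theorem towerInflIso_apply_of_le {E K : FiniteGaloisIntermediateField F Fbar} (h : E ≤ K)
    (h' : K ≤ E) {S S' : Set (Place F)} (hS : S ⊆ S') (f : Miso F E S) (u : Place K) :
    (towerInflIso h hS f).1 u = f.1 (Place.comap _ (inclusion_isIntegral h) u) := by
  let _ : Algebra E K := (IntermediateField.inclusion h).toRingHom.toAlgebra
  have : IsScalarTower F E K := IsScalarTower.of_algebraMap_eq' rfl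
  have : FiniteDimensional E K := FiniteDimensional.right F E K
  have : IsGalois E K := IsGalois.tower_top_of_isGalois F E K
  have : NumberField E := NumberField.of_module_finite F E
  have : CharZero K := charZero_of_injective_algebraMap (algebraMap F K).injective
  refine (inflIso_apply hS f u).trans ?_
  rw [Place.localDegree_eq_one_of_surjective (fun x => ⟨⟨x.1, h' x.2⟩, rfl⟩) u, Nat.cast_one,
    one_mul]
  rfl

theorem towerInflIso_refl {E : FiniteGaloisIntermediateField F Fbar} {S S' : Set (Place F)}
    (hS : S ⊆ S') (f : Miso F E S) : (towerInflIso le_rfl hS f).1 = f.1 := by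
  ext u
  rw [towerInflIso_apply_of_le le_rfl le_rfl]
  congr 1
  induction u using Place.ind with
  | h v hv => rfl

/-- A function in M^mid for S vanishes off the lifts of S, and distinct places of F have distinct
lifts, so enlarging the cut-off set only adds zeros. Thus inflation can be compared between a finite
S and the set of all places. -/
theorem inflMidFun_eq_of_subset {F E K : Type*} [Field F] [Field E] [Field K] [Algebra F E]
    [Algebra E K] [Algebra F K] [IsScalarTower F E K] [FiniteDimensional F E]
    [FiniteDimensional F K] [FiniteDimensional E K] [IsGalois F E] [IsGalois F K] [IsGalois E K]
    (d : PlaceLift F K) {e : PlaceLift F E} (he : d.under E = e) {S S' : Set (Place F)}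
    (hS : S ⊆ S') (f : Mmid e S) : inflMidFun d S f.1 = inflMidFun d S' f.1 := by
  classical
  subst he
  funext σ; ext u
  rw [inflMidFun_apply, inflMidFun_apply]
  by_cases h : σ⁻¹ • u ∈ d.lift '' S
  · rw [if_pos h, if_pos (Set.image_mono hS h)]
  · rw [if_neg h]
    split_ifs with h'
    · obtain ⟨v, -, hv⟩ := h'
      refine (f.2.2.2.2 _ _ ?_).symm
      rintro ⟨v', hv', hvv'⟩
      have h1 : (d.under E).lift v' = (d.under E).lift v := by
        rw [hvv', ← map_inv, ← Place.under_smul, ← hv]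
        rfl
      rw [PlaceSplitting.lift_injective _ h1] at hv'
      exact h ⟨v, hv', hv⟩
    · rfl

theorem towerInflMid_congr (V : PlaceLift F Fbar) {E K : FiniteGaloisIntermediateField F Fbar}
    (h : E ≤ K) {S S' T T' : Set (Place F)} (hS : S ⊆ T) (hS' : S' ⊆ T') (hSS : S ⊆ S')
    (f : Mmid (V.under E) S) (f' : Mmid (V.under E) S') (hf : f.1 = f'.1) :
    (towerInflMid V h hS f).1 = (towerInflMid V h hS' f').1 := by
  let _ : Algebra E K := (IntermediateField.inclusion h).toRingHom.toAlgebra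
  have : IsScalarTower F E K := IsScalarTower.of_algebraMap_eq' rfl
  have : IsScalarTower E K Fbar := IsScalarTower.of_algebraMap_eq' rfl
  have : FiniteDimensional E K := FiniteDimensional.right F E K
  have : IsGalois E K := IsGalois.tower_top_of_isGalois F E K
  change inflMidFun (V.under K) S f.1 = inflMidFun (V.under K) S' f'.1
  rw [← hf]
  exact inflMidFun_eq_of_subset _ (by simp only [PlaceLift.under, Place.under_under]) hSS f

-- Describing ρ by its compatibility with σ keeps the algebra structure of K over E out of the
-- statement. For K = E this compatibility forces ρ = σ.
open Classical in
theorem towerInflMid_apply (V : PlaceLift F Fbar) {E K : FiniteGaloisIntermediateField F Fbar}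
    (h : E ≤ K) {S S' : Set (Place F)} (hS : S ⊆ S') (f : Mmid (V.under E) S) (σ : Gal(K/F)) :
    ∃ ρ : Gal(E/F), (∀ x : E, IntermediateField.inclusion h (ρ x) =
        σ (IntermediateField.inclusion h x)) ∧
      ∀ u, (towerInflMid V h hS f).1 σ u = if σ⁻¹ • u ∈ (V.under K).lift '' S then
        f.1 ρ (Place.comap _ (inclusion_isIntegral h) u) else 0 := by
  let _ : Algebra E K := (IntermediateField.inclusion h).toRingHom.toAlgebra
  have : IsScalarTower F E K := IsScalarTower.of_algebraMap_eq' rfl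
  have : FiniteDimensional E K := FiniteDimensional.right F E K
  have : IsGalois E K := IsGalois.tower_top_of_isGalois F E K
  exact ⟨AlgEquiv.restrictNormalHom E σ, fun x => AlgEquiv.restrictNormal_commutes σ E x,
    fun u => inflMidFun_apply _ _ _ _ _⟩

theorem towerInflMid_refl (V : PlaceLift F Fbar) {E : FiniteGaloisIntermediateField F Fbar}
    {S S' : Set (Place F)} (hS : S ⊆ S') (f : Mmid (V.under E) S) :
    (towerInflMid V le_rfl hS f).1 = f.1 := by
  classical
  funext σ; ext u
  obtain ⟨ρ, hρ, hf⟩ := towerInflMid_apply V le_rfl hS f σ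
  have h1 : ρ = σ := AlgEquiv.ext hρ
  have h2 : Place.comap _ (inclusion_isIntegral (le_refl E)) u = u := by
    induction u using Place.ind with
    | h v hv => rfl
  rw [hf, h1, h2]
  split_ifs with h
  · rfl
  · exact (f.2.2.2.2 σ u h).symm

/-! ### Density and compatible splittings along a sequence -/

/-- If the decomposition groups of the chosen places are dense, then every automorphism of a finite
Galois subextension fixes one of the chosen places. -/
theorem exists_smul_lift_eq [IsGalois F Fbar] (V : PlaceLift F Fbar)
    (hV : Dense (⋃ v : Place F,
      (MulAction.stabilizer Gal(Fbar/F) (V.lift v) : Set Gal(Fbar/F))))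
    (E : FiniteGaloisIntermediateField F Fbar) (σ : Gal(E/F)) :
    ∃ v, σ • (V.under E).lift v = (V.under E).lift v := by
  obtain ⟨τ, hτ⟩ := AlgEquiv.restrictNormalHom_surjective (F := F) (K₁ := E) Fbar σ
  have hopen : IsOpen ((AlgEquiv.restrictNormalHom (F := F) (K₁ := Fbar) E) ⁻¹' {σ}) := by
    exact (isOpen_discrete _).preimage (InfiniteGalois.restrictNormalHom_continuous _)
  -- The automorphisms restricting to σ form a nonempty open set, which therefore meets the dense
  -- union.
  obtain ⟨γ, hγ', hγ⟩ := hV.exists_mem_open hopen ⟨τ, hτ⟩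
  obtain ⟨v, hv⟩ := Set.mem_iUnion.mp hγ'
  refine ⟨v, ?_⟩
  have h1 : γ • V.lift v = V.lift v := hv
  have h2 : AlgEquiv.restrictNormalHom E γ = σ := hγ
  change σ • Place.under E (V.lift v) = Place.under E (V.lift v)
  rw [← h2, ← Place.under_smul, h1]

/-- The extension step is applied to F ⊂ E and the identity matrix over F. -/
theorem PlaceSplitting.nonempty (V : PlaceLift F Fbar) (E : FiniteGaloisIntermediateField F Fbar)
    (hE : ∀ σ : Gal(E/F), ∃ v, σ • (V.under E).lift v = (V.under E).lift v) :
    Nonempty (PlaceSplitting (V.under E)) := by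
  have : CharZero E := charZero_of_injective_algebraMap (algebraMap F E).injective
  obtain ⟨b, -⟩ := PlaceSplitting.exists_extension (E := F) (V.under E) hE (PlaceSplitting.base _)
  exact ⟨b⟩

theorem PlaceSplitting.exists_tower_extension (V : PlaceLift F Fbar)
    {E K : FiniteGaloisIntermediateField F Fbar} (h : E ≤ K)
    (hK : ∀ σ : Gal(K/F), ∃ v, σ • (V.under K).lift v = (V.under K).lift v)
    (a : PlaceSplitting (V.under E)) :
    ∃ b : PlaceSplitting (V.under K), ∀ m,
      b.hom (towerInflIso h subset_rfl m) = towerInflMid V h subset_rfl (a.hom m) := by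
  let _ : Algebra E K := (IntermediateField.inclusion h).toRingHom.toAlgebra
  have : IsScalarTower F E K := IsScalarTower.of_algebraMap_eq' rfl
  have : IsScalarTower E K Fbar := IsScalarTower.of_algebraMap_eq' rfl
  have : FiniteDimensional E K := FiniteDimensional.right F E K
  have : IsGalois E K := IsGalois.tower_top_of_isGalois F E K
  have : NumberField E := NumberField.of_module_finite F E
  have : CharZero K := charZero_of_injective_algebraMap (algebraMap F K).injective
  have he : (V.under K).under E = V.under E := by
    simp only [PlaceLift.under, Place.under_under]
  obtain ⟨b, hb⟩ := PlaceSplitting.exists_extension (V.under K) hK (he.symm ▸ a)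
  refine ⟨b, fun m => PlaceSplitting.hom_inflIso he (fun w => ?_) m⟩
  rw [hb]
  -- The lifts to E induced directly and through K agree only propositionally; substituting the
  -- equality removes the transport of `a`.
  generalize V.under E = e at he a
  subst he
  rfl

/-- Dependent choice: each extension in the tower starts from the splitting chosen just before it.
-/
theorem exists_dependent_sequence {α : ℕ → Type*} (r : ∀ i, α i → α (i + 1) → Prop) (a₀ : α 0)
    (h : ∀ i a, ∃ b, r i a b) : ∃ f : ∀ i, α i, ∀ i, r i (f i) (f (i + 1)) := by
  choose next hnext using h
  exact ⟨fun i => Nat.rec a₀ next i, fun i => hnext i _⟩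

theorem PlaceSplitting.exists_sequence (V : PlaceLift F Fbar)
    (E : ℕ → FiniteGaloisIntermediateField F Fbar) (hE : Monotone E)
    (hV : ∀ i, ∀ σ : Gal(E i/F), ∃ v, σ • (V.under (E i)).lift v = (V.under (E i)).lift v) :
    ∃ a : ∀ i, PlaceSplitting (V.under (E i)), ∀ i m,
      (a (i + 1)).hom (towerInflIso (hE (Nat.le_succ i)) subset_rfl m) =
        towerInflMid V (hE (Nat.le_succ i)) subset_rfl ((a i).hom m) := by
  obtain ⟨a₀⟩ := PlaceSplitting.nonempty V (E 0) (hV 0)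
  exact exists_dependent_sequence (α := fun i => PlaceSplitting (V.under (E i)))
    (fun i a b => ∀ m, b.hom (towerInflIso (hE (Nat.le_succ i)) subset_rfl m) =
      towerInflMid V (hE (Nat.le_succ i)) subset_rfl (a.hom m)) a₀
    (fun i => PlaceSplitting.exists_tower_extension V (hE (Nat.le_succ i)) (hV (i + 1)))

/-- A finite Galois subextension is contained in some member of an exhausting increasing
sequence. -/
theorem exists_le_of_exhausting (E : ℕ → FiniteGaloisIntermediateField F Fbar)
    (hE : ∀ x : Fbar, ∃ i, x ∈ (E i).toIntermediateField)
    (X : FiniteGaloisIntermediateField F Fbar) : ∃ i, X ≤ E i := by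
  obtain ⟨α, hα⟩ := Field.exists_primitive_element F X
  obtain ⟨i, hi⟩ := hE α
  refine ⟨i, ?_⟩
  have h1 := congrArg IntermediateField.lift hα
  rw [IntermediateField.lift_adjoin_simple, IntermediateField.lift_top] at h1
  change X.toIntermediateField ≤ (E i).toIntermediateField
  rw [← h1]
  exact IntermediateField.adjoin_simple_le_iff.mpr hi

theorem exists_exhausting_sequence [IsGalois F Fbar] :
    ∃ E : ℕ → FiniteGaloisIntermediateField F Fbar, Monotone E ∧
      ∀ x : Fbar, ∃ i, x ∈ (E i).toIntermediateField := by
  have : CharZero Fbar := charZero_of_injective_algebraMap (algebraMap F Fbar).injective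
  -- Being algebraic over ℚ, F̄ is countable. The i-th field is the Galois extension generated by
  -- the first i + 1 elements of an enumeration.
  have : Algebra.IsAlgebraic ℚ Fbar := Algebra.IsAlgebraic.trans ℚ F Fbar
  have : Countable Fbar := by
    rw [← Set.countable_univ_iff, ← Set.eq_univ_of_forall
      (s := {x : Fbar | IsAlgebraic ℚ x}) Algebra.IsAlgebraic.isAlgebraic]
    exact Algebraic.countable ℚ Fbar
  obtain ⟨e, he⟩ := exists_surjective_nat Fbar
  refine ⟨fun i => FiniteGaloisIntermediateField.adjoin F (e '' Set.Iic i), fun i j hij => ?_,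
    fun x => ?_⟩
  · change IntermediateField.normalClosure _ _ _ ≤ IntermediateField.normalClosure _ _ _
    exact IntermediateField.normalClosure_mono _ _ (IntermediateField.adjoin.mono F _ _
      (Set.image_mono (Set.Iic_subset_Iic.mpr hij)))
  · obtain ⟨i, rfl⟩ := he x
    exact ⟨i, FiniteGaloisIntermediateField.subset_adjoin F _ ⟨i, Set.mem_Iic.mpr le_rfl, rfl⟩⟩

end TowerSplitting

/-! ### Evaluating points of the pro-tori at characters -/

section LimitSplitting

set_option linter.unusedSectionVars false

open CategoryTheory

variable {F Fbar : Type u} [Field F] [Field Fbar] [Algebra F Fbar]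

theorem proGroup.eval_infl {X : CharacterSystem F Fbar} {R : CommAlgCat.{u} F}
    (t : (proGroup X).obj R) {i j : Level F Fbar} (h : i ≤ j) (m : X.M i) :
    proGroup.eval t j (X.infl h m) = proGroup.eval t i m :=
  Subtype.property (p := fun t => t ∈ limPoints X R) t h m

theorem proGroup.eval_add {X : CharacterSystem F Fbar} {R : CommAlgCat.{u} F}
    (t : (proGroup X).obj R) (i : Level F Fbar) (m m' : X.M i) :
    proGroup.eval t i (m + m') = proGroup.eval t i m * proGroup.eval t i m' :=
  map_mul (Subtype.val (p := fun t => t ∈ limPoints X R) t i).1 _ _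

theorem proGroup.eval_smul {X : CharacterSystem F Fbar} {R : CommAlgCat.{u} F}
    (t : (proGroup X).obj R) (i : Level F Fbar) (σ : Gal(Fbar/F)) (m : X.M i) :
    proGroup.eval t i (σ • m) =
      Units.map (galTensor Fbar R σ).toRingHom.toMonoidHom (proGroup.eval t i m) :=
  (Subtype.val (p := fun t => t ∈ limPoints X R) t i).2 σ m

variable [NumberField F] [Algebra.IsAlgebraic F Fbar]

/-- The value of a point of `𝕋^iso` at a function does not depend on the set of places. -/
theorem eval_iso_congr {R : CommAlgCat.{u} F} (t : (Tiso F Fbar).obj R)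
    {E : FiniteGaloisIntermediateField F Fbar} {S S' : Finset (Place F)}
    (m : Miso F E (S : Set (Place F))) (m' : Miso F E (S' : Set (Place F))) (h : m.1 = m'.1) :
    proGroup.eval (X := isoSystem F Fbar) t (E, S) m =
      proGroup.eval (X := isoSystem F Fbar) t (E, S') m' := by
  classical
  -- The two values are compared at level (E, S ∪ S'), to which inflation does not change the
  -- underlying functions.
  have h1 : ((E, S) : Level F Fbar) ≤ (E, S ∪ S') := ⟨le_rfl, Finset.subset_union_left⟩
  have h2 : ((E, S') : Level F Fbar) ≤ (E, S ∪ S') := ⟨le_rfl, Finset.subset_union_right⟩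
  have h3 : (isoSystem F Fbar).infl h1 m = (isoSystem F Fbar).infl h2 m' :=
    Subtype.ext ((towerInflIso_refl (Finset.coe_subset.mpr h1.2) m).trans
      (h.trans (towerInflIso_refl (Finset.coe_subset.mpr h2.2) m').symm))
  exact (proGroup.eval_infl t h1 m).symm.trans
    ((congrArg (proGroup.eval t _) h3).trans (proGroup.eval_infl t h2 m'))

/-- The value of a point of `𝕋^mid` at a function does not depend on the set of places. -/
theorem eval_mid_congr {V : PlaceLift F Fbar} {R : CommAlgCat.{u} F} (t : (Tmid V).obj R)
    {E : FiniteGaloisIntermediateField F Fbar} {S S' : Finset (Place F)}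
    (m : Mmid (V.under E) (S : Set (Place F))) (m' : Mmid (V.under E) (S' : Set (Place F)))
    (h : m.1 = m'.1) :
    proGroup.eval (X := midSystem V) t (E, S) m = proGroup.eval (X := midSystem V) t (E, S') m' := by
  classical
  have h1 : ((E, S) : Level F Fbar) ≤ (E, S ∪ S') := ⟨le_rfl, Finset.subset_union_left⟩
  have h2 : ((E, S') : Level F Fbar) ≤ (E, S ∪ S') := ⟨le_rfl, Finset.subset_union_right⟩
  have h3 : (midSystem V).infl h1 m = (midSystem V).infl h2 m' :=
    Subtype.ext ((towerInflMid_refl V (Finset.coe_subset.mpr h1.2) m).trans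
      (h.trans (towerInflMid_refl V (Finset.coe_subset.mpr h2.2) m').symm))
  exact (proGroup.eval_infl t h1 m).symm.trans
    ((congrArg (proGroup.eval t _) h3).trans (proGroup.eval_infl t h2 m'))

open Classical in
/-- The finite set of places of `F` below the support of an element of `M^mid`. -/
noncomputable def Mmid.places {E : FiniteGaloisIntermediateField F Fbar} {d : PlaceLift F E}
    (m : Mmid d Set.univ) : Finset (Place F) :=
  Finset.univ.biUnion fun σ => (m.1 σ).support.image (Place.under F)

/-- A splitting need not preserve a finite set S, because the columns p(x) may lie outside S. Its
values still have finite support, so each of them belongs to the module of some finite set and can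
be evaluated at a point of the limit. -/
theorem Mmid.mem_of_places_subset {E : FiniteGaloisIntermediateField F Fbar} {d : PlaceLift F E}
    (m : Mmid d Set.univ) {S : Finset (Place F)} (hS : Mmid.places m ⊆ S) :
    m.1 ∈ Mmid d (S : Set (Place F)) := by
  classical
  refine ⟨m.2.1, m.2.2.1, m.2.2.2.1, fun σ w h => ?_⟩
  by_contra hne
  have h1 : σ⁻¹ • w ∈ d.lift '' Set.univ := by
    by_contra h'
    exact hne (m.2.2.2.2 σ w h')
  obtain ⟨v, -, hv⟩ := h1
  refine h ⟨v, hS ?_, hv⟩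
  simp only [places, Finset.mem_biUnion, Finset.mem_image, Finset.mem_univ, true_and]
  refine ⟨σ, w, Finsupp.mem_support_iff.mpr hne, ?_⟩
  rw [← d.under_lift v, hv, Place.under_smul_self]

/-- The value of a point of `𝕋^mid` at an element of `M^mid` for the set of all places. -/
noncomputable def evalMid {V : PlaceLift F Fbar} {R : CommAlgCat.{u} F} (t : (Tmid V).obj R)
    {E : FiniteGaloisIntermediateField F Fbar} (m : Mmid (V.under E) Set.univ) :
    ((R : Type u) ⊗[F] Fbar)ˣ :=
  proGroup.eval (X := midSystem V) t (E, Mmid.places m) ⟨m.1, Mmid.mem_of_places_subset m subset_rfl⟩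

section EvalMid

variable {V : PlaceLift F Fbar} {R : CommAlgCat.{u} F} (t : (Tmid V).obj R)
  {E K : FiniteGaloisIntermediateField F Fbar}

theorem evalMid_eq (m : Mmid (V.under E) Set.univ) {S : Finset (Place F)}
    (m' : Mmid (V.under E) (S : Set (Place F))) (h : m.1 = m'.1) :
    evalMid t m = proGroup.eval (X := midSystem V) t (E, S) m' :=
  eval_mid_congr t _ _ h

theorem evalMid_add (m m' : Mmid (V.under E) Set.univ) :
    evalMid t (m + m') = evalMid t m * evalMid t m' := by
  classical
  let n : Mmid (V.under E) ((Mmid.places m ∪ Mmid.places m' : Finset _) : Set (Place F)) :=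
    ⟨m.1, Mmid.mem_of_places_subset m Finset.subset_union_left⟩
  let n' : Mmid (V.under E) ((Mmid.places m ∪ Mmid.places m' : Finset _) : Set (Place F)) :=
    ⟨m'.1, Mmid.mem_of_places_subset m' Finset.subset_union_right⟩
  rw [evalMid_eq t m n rfl, evalMid_eq t m' n' rfl, evalMid_eq t (m + m') (n + n') rfl]
  exact proGroup.eval_add t _ _ _

theorem evalMid_smul (σ : Gal(Fbar/F)) (m : Mmid (V.under E) Set.univ) :
    evalMid t (AlgEquiv.restrictNormalHom (F := F) (K₁ := Fbar) E σ • m) =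
      Units.map (galTensor Fbar R σ).toRingHom.toMonoidHom (evalMid t m) := by
  let n : Mmid (V.under E) (Mmid.places m : Set (Place F)) :=
    ⟨m.1, Mmid.mem_of_places_subset m subset_rfl⟩
  refine (evalMid_eq t _ (AlgEquiv.restrictNormalHom (F := F) (K₁ := Fbar) E σ • n) rfl).trans ?_
  exact proGroup.eval_smul (X := midSystem V) t (E, Mmid.places m) σ n

theorem evalMid_towerInflMid (h : E ≤ K) (m : Mmid (V.under E) Set.univ) :
    evalMid t (towerInflMid V h subset_rfl m) = evalMid t m := by
  let n : Mmid (V.under E) (Mmid.places m : Set (Place F)) :=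
    ⟨m.1, Mmid.mem_of_places_subset m subset_rfl⟩
  -- The places below the support of m serve at both levels, so compatibility of the point t with
  -- this single transition map suffices.
  have h1 : ((E, Mmid.places m) : Level F Fbar) ≤ (K, Mmid.places m) := ⟨h, le_rfl⟩
  rw [evalMid_eq t _ (towerInflMid V h subset_rfl n)
    (towerInflMid_congr V h subset_rfl subset_rfl (Set.subset_univ _) n m rfl).symm]
  exact proGroup.eval_infl t h1 n

theorem evalMid_towerInflIso_smul
    (s : Miso F K Set.univ →+[Gal(K/F)] Mmid (V.under K) Set.univ) (h : E ≤ K)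
    {S : Set (Place F)} (σ : Gal(Fbar/F)) (m : Miso F E S) :
    evalMid t (s (towerInflIso h (Set.subset_univ S) (σ • m))) =
      Units.map (galTensor Fbar R σ).toRingHom.toMonoidHom
        (evalMid t (s (towerInflIso h (Set.subset_univ S) m))) := by
  rw [towerInflIso_smul, ← evalMid_smul]
  exact congrArg (evalMid t)
    (map_smul s (AlgEquiv.restrictNormalHom (F := F) (K₁ := Fbar) K σ) _)

/-- The set S may be smaller than the set of places below m. This matters for m = s(f): its image f
under c^iso lives over S even when m does not. -/
theorem evalMid_cIso (t : (Tiso F Fbar).obj R) (m : Mmid (V.under E) Set.univ)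
    {S : Finset (Place F)} (m' : Miso F E (S : Set (Place F)))
    (h : (ciso (V.under E) Set.univ m).1 = m'.1) :
    evalMid (((cIso V).app R).hom t) m = proGroup.eval (X := isoSystem F Fbar) t (E, S) m' :=
  eval_iso_congr t (ciso (V.under E) _ ⟨m.1, Mmid.mem_of_places_subset m subset_rfl⟩) m' h

/-- `evalMid` as a homomorphism. -/
noncomputable def evalMidHom (E : FiniteGaloisIntermediateField F Fbar) :
    Mmid (V.under E) Set.univ →+ Additive ((R : Type u) ⊗[F] Fbar)ˣ :=
  AddMonoidHom.mk' (fun m => Additive.ofMul (evalMid t m)) (evalMid_add t)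

/-- The pull-back of a point of `𝕋^mid` along a splitting at level `K`, as a point of
`𝕋^iso_{E,S}` for `E ≤ K`. -/
noncomputable def pullbackPoint (s : Miso F K Set.univ →+[Gal(K/F)] Mmid (V.under K) Set.univ)
    (h : E ≤ K) (S : Set (Place F)) : multPoints (F := F) Fbar (Miso F E S) R :=
  ⟨AddMonoidHom.toMultiplicativeLeft (((evalMidHom t K).comp
      (s : Miso F K Set.univ →+ Mmid (V.under K) Set.univ)).comp
      (towerInflIso h (Set.subset_univ S))),
    evalMid_towerInflIso_smul t s h⟩

end EvalMid

/-! ### The splitting in the limit -/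

variable {V : PlaceLift F Fbar} {E : ℕ → FiniteGaloisIntermediateField F Fbar} (hE : Monotone E)
  {s : ∀ i, Miso F (E i) Set.univ →+[Gal(E i/F)] Mmid (V.under (E i)) Set.univ}

/-- By induction on j: the hypothesis `hs` trades one inflation on the iso side for one on the mid
side, and the latter does not change values of a point. -/
theorem evalMid_towerInflIso
    (hs : ∀ i m, s (i + 1) (towerInflIso (hE (Nat.le_succ i)) subset_rfl m) =
      towerInflMid V (hE (Nat.le_succ i)) subset_rfl (s i m))
    {R : CommAlgCat.{u} F} (t : (Tmid V).obj R) {i j : ℕ} (h : i ≤ j)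
    (m : Miso F (E i) Set.univ) :
    evalMid t (s j (towerInflIso (hE h) subset_rfl m)) = evalMid t (s i m) := by
  induction j, h using Nat.le_induction with
  | base =>
    have : towerInflIso (hE (le_refl i)) subset_rfl m = m := Subtype.ext (towerInflIso_refl _ m)
    rw [this]
  | succ j h ih =>
    rw [← towerInflIso_towerInflIso (hE h) (hE (Nat.le_succ j)) subset_rfl subset_rfl, hs,
      evalMid_towerInflMid, ih]

/-- The pull-back of a character does not depend on the member of the sequence used to compute it.
Hence an arbitrary choice of indices is harmless in `limitSplitting`. -/
theorem evalMid_congr_index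
    (hs : ∀ i m, s (i + 1) (towerInflIso (hE (Nat.le_succ i)) subset_rfl m) =
      towerInflMid V (hE (Nat.le_succ i)) subset_rfl (s i m))
    {R : CommAlgCat.{u} F} (t : (Tmid V).obj R)
    {X : FiniteGaloisIntermediateField F Fbar} {S : Set (Place F)} (m : Miso F X S) {i j : ℕ}
    (hi : X ≤ E i) (hj : X ≤ E j) :
    evalMid t (s i (towerInflIso hi (Set.subset_univ S) m)) =
      evalMid t (s j (towerInflIso hj (Set.subset_univ S) m)) := by
  wlog h : i ≤ j generalizing i j
  · exact (this hj hi (le_of_not_ge h)).symm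
  · rw [← evalMid_towerInflIso hE hs t h, towerInflIso_towerInflIso]

/-- The splitting of `c_iso` defined by compatible splittings along an exhausting sequence. -/
noncomputable def limitSplitting
    (hs : ∀ i m, s (i + 1) (towerInflIso (hE (Nat.le_succ i)) subset_rfl m) =
      towerInflMid V (hE (Nat.le_succ i)) subset_rfl (s i m))
    (N : FiniteGaloisIntermediateField F Fbar → ℕ)
    (hN : ∀ X, X ≤ E (N X)) : Tmid V ⟶ Tiso F Fbar where
  app R := CommGrpCat.ofHom
    { toFun := fun t => ⟨fun X => pullbackPoint t (s (N X.1)) (hN X.1) (X.2 : Set (Place F)),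
        fun {X Y} h m => by
          -- Both sides inflate the same character of level X, one to the field chosen for Y and the
          -- other to the field chosen for X; index independence identifies them.
          refine Eq.trans ?_ (evalMid_congr_index hE hs t m (h.1.trans (hN Y.1)) (hN X.1))
          exact congrArg (fun m => evalMid t (s (N Y.1) m))
            (towerInflIso_towerInflIso h.1 (hN Y.1) (Finset.coe_subset.mpr h.2)
              (Set.subset_univ _) m)⟩
      map_one' := rfl
      map_mul' := fun _ _ => rfl }
  naturality _ _ φ := by ext t; rfl

theorem cIso_limitSplitting
    (hs : ∀ i m, s (i + 1) (towerInflIso (hE (Nat.le_succ i)) subset_rfl m) =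
      towerInflMid V (hE (Nat.le_succ i)) subset_rfl (s i m))
    (hc : ∀ i m, ciso (V.under (E i)) Set.univ (s i m) = m)
    (N : FiniteGaloisIntermediateField F Fbar → ℕ) (hN : ∀ X, X ≤ E (N X)) :
    cIso V ≫ limitSplitting hE hs N hN = 𝟙 (Tiso F Fbar) := by
  ext R t
  refine Subtype.ext (funext fun X => Subtype.ext (MonoidHom.ext fun m => ?_))
  have hX : X ≤ (E (N X.1), X.2) := ⟨hN X.1, le_rfl⟩
  -- At the chosen field c^iso ∘ s is the identity, so the value is that of t at the inflated
  -- character, which equals its value at the character itself.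
  refine (evalMid_cIso t _ (towerInflIso (hN X.1) subset_rfl m.toAdd) ?_).trans
    (proGroup.eval_infl t hX m.toAdd)
  exact congrArg Subtype.val (hc (N X.1) _)

theorem eval_limitSplitting
    (hs : ∀ i m, s (i + 1) (towerInflIso (hE (Nat.le_succ i)) subset_rfl m) =
      towerInflMid V (hE (Nat.le_succ i)) subset_rfl (s i m))
    (N : FiniteGaloisIntermediateField F Fbar → ℕ)
    (hN : ∀ X, X ≤ E (N X)) (R : CommAlgCat.{u} F) (t : (Tmid V).obj R) (i : ℕ)
    (S S' : Finset (Place F)) (m : Miso F (E i) Set.univ)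
    (hm : m.1 ∈ Miso F (E i) (S : Set (Place F)))
    (hm' : (s i m).1 ∈ Mmid (V.under (E i)) (S' : Set (Place F))) :
    proGroup.eval (X := isoSystem F Fbar) (((limitSplitting hE hs N hN).app R).hom t) (E i, S)
        ⟨m.1, hm⟩ =
      proGroup.eval (X := midSystem V) t (E i, S') ⟨(s i m).1, hm'⟩ := by
  let m₀ : Miso F (E i) (S : Set (Place F)) := ⟨m.1, hm⟩
  have h1 : towerInflIso (le_refl (E i)) (Set.subset_univ _) m₀ = m :=
    Subtype.ext (towerInflIso_refl _ m₀)
  -- The index chosen for the field E i need not be i, and is replaced by i here.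
  refine (evalMid_congr_index hE hs t m₀ (hN (E i)) le_rfl).trans ?_
  rw [h1]
  exact evalMid_eq t _ _ rfl

end LimitSplitting

end GaloisGerbe

/-! ### The theorem -/

theorem mainTheorem12 {F Fbar : Type u} [Field F] [NumberField F] [Field Fbar] [Algebra F Fbar]
    [Algebra.IsAlgebraic F Fbar] [IsAlgClosed Fbar] (V : PlaceLift F Fbar)
    (hV : Dense (⋃ v : Place F,
      (MulAction.stabilizer Gal(Fbar/F) (V.lift v) : Set Gal(Fbar/F)))) :
    (∃ s : Tmid V ⟶ Tiso F Fbar, cIso V ≫ s = 𝟙 (Tiso F Fbar)) ∧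
    ∀ (E : ℕ → FiniteGaloisIntermediateField F Fbar) (hE : Monotone E),
      (∀ x : Fbar, ∃ i, x ∈ (E i).toIntermediateField) →
      ∃ s : ∀ i, Miso F (E i) Set.univ →+[Gal(E i/F)] Mmid (V.under (E i)) Set.univ,
        (∀ i m, ciso (V.under (E i)) Set.univ (s i m) = m) ∧
        (∀ i m, s (i + 1) (towerInflIso (hE (Nat.le_succ i)) subset_rfl m) =
          towerInflMid V (hE (Nat.le_succ i)) subset_rfl (s i m)) ∧
        ∃ sT : Tmid V ⟶ Tiso F Fbar, cIso V ≫ sT = 𝟙 (Tiso F Fbar) ∧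
          ∀ (R : CommAlgCat.{u} F) (t : (Tmid V).obj R) (i : ℕ) (S S' : Finset (Place F))
            (m : Miso F (E i) Set.univ) (hm : m.1 ∈ Miso F (E i) (S : Set (Place F)))
            (hm' : (s i m).1 ∈ Mmid (V.under (E i)) (S' : Set (Place F))),
            proGroup.eval (X := isoSystem F Fbar) ((sT.app R).hom t) (E i, S) ⟨m.1, hm⟩ =
              proGroup.eval (X := midSystem V) t (E i, S') ⟨(s i m).1, hm'⟩ := by
  have : IsAlgClosure F Fbar := ⟨inferInstance, inferInstance⟩
  have : IsGalois F Fbar := ⟨⟩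
  have key : ∀ (E : ℕ → FiniteGaloisIntermediateField F Fbar) (hE : Monotone E),
      (∀ x : Fbar, ∃ i, x ∈ (E i).toIntermediateField) →
      ∃ s : ∀ i, Miso F (E i) Set.univ →+[Gal(E i/F)] Mmid (V.under (E i)) Set.univ,
        (∀ i m, ciso (V.under (E i)) Set.univ (s i m) = m) ∧
        (∀ i m, s (i + 1) (towerInflIso (hE (Nat.le_succ i)) subset_rfl m) =
          towerInflMid V (hE (Nat.le_succ i)) subset_rfl (s i m)) ∧
        ∃ sT : Tmid V ⟶ Tiso F Fbar, cIso V ≫ sT = 𝟙 (Tiso F Fbar) ∧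
          ∀ (R : CommAlgCat.{u} F) (t : (Tmid V).obj R) (i : ℕ) (S S' : Finset (Place F))
            (m : Miso F (E i) Set.univ) (hm : m.1 ∈ Miso F (E i) (S : Set (Place F)))
            (hm' : (s i m).1 ∈ Mmid (V.under (E i)) (S' : Set (Place F))),
            proGroup.eval (X := isoSystem F Fbar) ((sT.app R).hom t) (E i, S) ⟨m.1, hm⟩ =
              proGroup.eval (X := midSystem V) t (E i, S') ⟨(s i m).1, hm'⟩ := by
    intro E hE hex
    obtain ⟨a, ha⟩ := PlaceSplitting.exists_sequence V E hE
      fun i => exists_smul_lift_eq V hV (E i)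
    choose N hN using exists_le_of_exhausting E hex
    exact ⟨fun i => (a i).hom, fun i => (a i).ciso_hom, ha, limitSplitting hE ha N hN,
      cIso_limitSplitting hE ha (fun i => (a i).ciso_hom) N hN, eval_limitSplitting hE ha N hN⟩
  -- The splitting with no prescribed sequence comes from any one exhausting sequence.
  obtain ⟨E, hE, hex⟩ := exists_exhausting_sequence (F := F) (Fbar := Fbar)
  obtain ⟨_, -, -, sT, hsT, -⟩ := key E hE hex
  exact ⟨⟨sT, hsT⟩, key⟩
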